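/- Let $G\subseteq \mathrm{GL}_n(\mathbb C)$ be a reductive linear algebraic group (a Zariski closed subgroup all of whose finite-dimensional algebraic representations are completely reducible), not necessarily connected, with Lie algebra $\mathfrak g$. Let $V$ be a finite-dimensional complex vector space with a non-degenerate symmetric bilinear form $\langle\cdot\,|\,\cdot\rangle$, and let $G\to O(V)$ be an algebraic representation preserving this form. Let $\mathfrak g$ act on $V$ by the differential of the representation, so that $\mathfrak g v=T_v(Gv)$ for $v\in V$. "For sufficiently general $v$" means: for all $v$ in some non-empty Zariski open subset. The following are equivalent: (1) There is a linear subspace $V_0\subseteq V$ such that, for sufficiently general $v_0\in V_0$, the space $V$ is the orthogonal direct sum of $V_0$ and $\mathfrak g v_0=T_{v_0}(Gv_0)$. (2) For sufficiently general $v\in V$ and for all $u_1,u_2\in V$ with $u_1\perp\mathfrak g v$ and $u_2\perp \mathfrak g v$, we have $u_1\perp\mathfrak g u_2$. (3) Let $(\varphi_i)_i$ be a basis of $\mathfrak g$, let $U=W=V$, let $\mathbb C[U\times W]_{(1)}$ be the space of linear forms on $U\times W$, and let $\mathbb C(V^*)$ be the field of rational functions on $V$. For the generic vector $v$ of $V$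 (whose coordinates with respect to a basis of $V$ are the coordinate functions in $\mathbb C(V^*)$) and for every $j$, $$\langle u|\varphi_j w\rangle\in \operatorname{span}_{\mathbb C(V^*)}\Bigl(\mathbb C[U\times W]_{(1)}\cdot\bigl\{\langle u|\varphi_i v\rangle,\ \langle w|\varphi_i v\rangle \bigm| i\bigr\}\Bigr),$$ the span being taken in $\mathbb C(V^*)\otimes_{\mathbb C}\mathbb C[U\times W]$, where $u\in U$ and $w\in W$ denote the variable points. The equivalence with (3) holds for every choice of bases of $\mathfrak g$ and of $V$. -/

import Mathlib

namespace PolarRep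

/-- The vector of matrix entries of an element of `GL n`, as a point at which polynomials in the
`n × n` entries can be evaluated. -/
def entries {n : ℕ} (g : GL (Fin n) ℂ) : Fin n × Fin n → ℂ :=
  fun ij => (g : Matrix (Fin n) (Fin n) ℂ) ij.1 ij.2

/-- `G` is a Zariski closed subgroup of `GL n`, i.e. a linear algebraic group: it is cut out
in `GL n` by a set of polynomials in the matrix entries. -/
def IsZariskiClosed {n : ℕ} (G : Subgroup (GL (Fin n) ℂ)) : Prop :=
  ∃ S : Set (MvPolynomial (Fin n × Fin n) ℂ),
    ∀ g : GL (Fin n) ℂ, g ∈ G ↔ ∀ p ∈ S, MvPolynomial.eval (entries g) p = 0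

/-- The coordinate ring `ℂ[G]`: the algebra of functions on `G` generated by the matrix entries
and the inverse of the determinant. -/
def coordRing {n : ℕ} (G : Subgroup (GL (Fin n) ℂ)) : Subalgebra ℂ (G → ℂ) :=
  Algebra.adjoin ℂ
    (Set.range (fun (ij : Fin n × Fin n) (g : G) => entries (g : GL (Fin n) ℂ) ij) ∪
      {fun g : G => ((g : GL (Fin n) ℂ) : Matrix (Fin n) (Fin n) ℂ).det⁻¹})

/-- The Lie algebra of `G` (as a vector space): the tangent space of `G` at the identity, that is,
the space of point derivations of `ℂ[G]` at `1`. -/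
def lieAlg {n : ℕ} (G : Subgroup (GL (Fin n) ℂ)) : Submodule ℂ (Module.Dual ℂ (coordRing G)) where
  carrier := {δ | ∀ f h : coordRing G,
    δ (f * h) = (f : G → ℂ) 1 * δ h + (h : G → ℂ) 1 * δ f}
  add_mem' := by
    intro a b ha hb f h
    simp only [LinearMap.add_apply, ha f h, hb f h]
    ring
  zero_mem' := by
    intro f h
    simp
  smul_mem' := by
    intro c a ha f h
    simp only [LinearMap.smul_apply, ha f h, smul_eq_mul]
    ring

section Representations

variable {n : ℕ} {G : Subgroup (GL (Fin n) ℂ)}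
variable {V : Type*} [AddCommGroup V] [Module ℂ V]

/-- The representation `ρ` is algebraic (rational): all its matrix coefficients are regular
functions on `G`. -/
def IsAlgebraicRep (ρ : Representation ℂ G V) : Prop :=
  ∀ (l : Module.Dual ℂ V) (v : V), (fun g : G => l (ρ g v)) ∈ coordRing G

/-- `G` is a reductive (not necessarily connected) linear algebraic group over `ℂ`: it is Zariski
closed in `GL n`, and all its finite-dimensional algebraic representations are completely
reducible. -/
def IsReductive {n : ℕ} (G : Subgroup (GL (Fin n) ℂ)) : Prop :=
  IsZariskiClosed G ∧
    ∀ (m : ℕ) (σ : Representation ℂ G (Fin m → ℂ)),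
      IsAlgebraicRep σ → σ.IsSemisimpleRepresentation

/-- The matrix coefficient `g ↦ l (ρ g v)` as an element of `ℂ[G]`, bilinear in `v` and `l`. -/
def matrixCoeff {ρ : Representation ℂ G V} (hρ : IsAlgebraicRep ρ) :
    V →ₗ[ℂ] Module.Dual ℂ V →ₗ[ℂ] coordRing G :=
  LinearMap.mk₂ ℂ (fun v l => ⟨fun g : G => l (ρ g v), hρ l v⟩)
    (fun v v' l => Subtype.ext (funext fun g => by simp))
    (fun c v l => Subtype.ext (funext fun g => by simp))
    (fun v l l' => Subtype.ext (funext fun g => by simp))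
    (fun c v l => Subtype.ext (funext fun g => by simp))

variable [FiniteDimensional ℂ V]

/-- The differential of `ρ` at the identity: the action of the Lie algebra of `G` on `V`.
It is characterised by `l (dρ δ v) = δ (g ↦ l (ρ g v))`, see `apply_differential`. -/
noncomputable def differential {ρ : Representation ℂ G V} (hρ : IsAlgebraicRep ρ) :
    lieAlg G →ₗ[ℂ] Module.End ℂ V where
  toFun δ := (Module.evalEquiv ℂ V).symm.toLinearMap ∘ₗ
    (matrixCoeff hρ).compr₂ (δ : Module.Dual ℂ (coordRing G))
  map_add' δ δ' := by
    ext v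
    simp only [LinearMap.comp_apply, LinearMap.add_apply, LinearEquiv.coe_coe, ← map_add]
    rfl
  map_smul' c δ := by
    ext v
    exact (Module.evalEquiv ℂ V).symm.map_smul c
      ((matrixCoeff hρ).compr₂ (δ : Module.Dual ℂ (coordRing G)) v)

theorem apply_differential {ρ : Representation ℂ G V} (hρ : IsAlgebraicRep ρ) (δ : lieAlg G)
    (v : V) (l : Module.Dual ℂ V) :
    l (differential hρ δ v) = (δ : Module.Dual ℂ (coordRing G)) (matrixCoeff hρ v l) :=
  Module.apply_evalEquiv_symm_apply (R := ℂ) (M := V) l _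

/-- The tangent space `𝔤 v` at `v` to the orbit `G v`: the image of the differential at `1` of the
orbit map `g ↦ ρ g v`. -/
noncomputable def orbitTangent {ρ : Representation ℂ G V} (hρ : IsAlgebraicRep ρ) (v : V) :
    Submodule ℂ V :=
  LinearMap.range ((differential hρ).flip v)

end Representations

/-- `P` holds for sufficiently general `v ∈ V`: it holds on a nonempty (hence dense) Zariski open
subset, equivalently on the locus where some polynomial function that is not identically zero on
`V` does not vanish. Polynomial functions on `V` are polynomials in linear functionals. -/
def ForGeneral {V : Type*} [AddCommGroup V] [Module ℂ V] (P : V → Prop) : Prop :=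
  ∃ p : MvPolynomial (Module.Dual ℂ V) ℂ,
    (∃ v : V, MvPolynomial.eval (fun l : Module.Dual ℂ V => l v) p ≠ 0) ∧
    ∀ v : V, MvPolynomial.eval (fun l : Module.Dual ℂ V => l v) p ≠ 0 → P v

section Criteria

variable {n : ℕ} {G : Subgroup (GL (Fin n) ℂ)}
variable {V : Type*} [AddCommGroup V] [Module ℂ V] [FiniteDimensional ℂ V]

/-- There is a subspace `V₀` such that, for sufficiently general `v₀ ∈ V₀`, the space `V` is the
orthogonal direct sum of `V₀` and the tangent space at `v₀` to its `G`-orbit. -/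
def HasSection {ρ : Representation ℂ G V} (hρ : IsAlgebraicRep ρ)
    (B : LinearMap.BilinForm ℂ V) : Prop :=
  ∃ V₀ : Submodule ℂ V, ForGeneral fun v₀ : V₀ =>
    IsCompl V₀ (orbitTangent hρ (v₀ : V)) ∧
      ∀ x ∈ V₀, ∀ y ∈ orbitTangent hρ (v₀ : V), B x y = 0

/-- For sufficiently general `v ∈ V` and all `u₁, u₂ ⊥ 𝔤 v` we have `u₁ ⊥ 𝔤 u₂`. -/
def GenerallyTransitive {ρ : Representation ℂ G V} (hρ : IsAlgebraicRep ρ)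
    (B : LinearMap.BilinForm ℂ V) : Prop :=
  ForGeneral fun v : V => ∀ u₁ u₂ : V,
    (∀ y ∈ orbitTangent hρ v, B u₁ y = 0) → (∀ y ∈ orbitTangent hρ v, B u₂ y = 0) →
      ∀ y ∈ orbitTangent hρ u₂, B u₁ y = 0

/-- The field `ℂ(V^*)` of rational functions on `V`, in terms of `m = dim V` linear coordinates. -/
abbrev RatFunField (m : ℕ) : Type := FractionRing (MvPolynomial (Fin m) ℂ)

/-- The scalar extension to `ℂ(V^*)` of the coordinate ring `ℂ[U × W]`, where `U = W = V`: the
variables `Sum.inl k` are the coordinates of `u ∈ U`, the variables `Sum.inr k` those of `w ∈ W`. -/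
abbrev PairRing (m : ℕ) : Type := MvPolynomial (Fin m ⊕ Fin m) (RatFunField m)

/-- The linear form `⟨u | φ v⟩` (for `s = Sum.inl`) or `⟨w | φ v⟩` (for `s = Sum.inr`), where
`v = ∑ x_l b_l` is the generic point of `V`, in coordinates with respect to the basis `b`. -/
noncomputable def genericPairing {m : ℕ} (B : LinearMap.BilinForm ℂ V)
    (b : Module.Basis (Fin m) ℂ V) (s : Fin m → Fin m ⊕ Fin m) (φ : Module.End ℂ V) :
    PairRing m :=
  ∑ k, ∑ l,
    MvPolynomial.C (algebraMap ℂ (RatFunField m) (B (b k) (φ (b l))) *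
      algebraMap (MvPolynomial (Fin m) ℂ) (RatFunField m) (MvPolynomial.X l)) *
    MvPolynomial.X (s k)

/-- The quadratic form `⟨u | φ w⟩` on `U × W`, in coordinates with respect to the basis `b`. -/
noncomputable def quadraticPairing {m : ℕ} (B : LinearMap.BilinForm ℂ V)
    (b : Module.Basis (Fin m) ℂ V) (φ : Module.End ℂ V) : PairRing m :=
  ∑ k, ∑ l,
    MvPolynomial.C (algebraMap ℂ (RatFunField m) (B (b k) (φ (b l)))) *
      (MvPolynomial.X (Sum.inl k) * MvPolynomial.X (Sum.inr l))

/-- The set `ℂ[U × W]_(1) · {⟨u | φ_i v⟩, ⟨w | φ_i v⟩}` of products of a linear form on `U × W`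
with one of the given linear forms. -/
def products {m : ℕ} (B : LinearMap.BilinForm ℂ V) (b : Module.Basis (Fin m) ℂ V)
    {κ : Type} (φ : κ → Module.End ℂ V) : Set (PairRing m) :=
  {f | ∃ q : MvPolynomial (Fin m ⊕ Fin m) ℂ, q.IsHomogeneous 1 ∧ ∃ i : κ,
    f = MvPolynomial.map (algebraMap ℂ (RatFunField m)) q * genericPairing B b Sum.inl (φ i) ∨
    f = MvPolynomial.map (algebraMap ℂ (RatFunField m)) q * genericPairing B b Sum.inr (φ i)}

/-- Each `⟨u | φ_j w⟩` lies in the `ℂ(V^*)`-linear span of the products of a linear form on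
`U × W` with one of the linear forms `⟨u | φ_i v⟩`, `⟨w | φ_i v⟩`. -/
def RationalCriterion {m : ℕ} (B : LinearMap.BilinForm ℂ V) (b : Module.Basis (Fin m) ℂ V)
    {κ : Type} (φ : κ → Module.End ℂ V) : Prop :=
  ∀ j : κ, quadraticPairing B b (φ j) ∈ Submodule.span (RatFunField m) (products B b φ)

end Criteria

end PolarRep

namespace PolarRep

open Module

/-! ### The Lie algebra acting through a representation and through its conjugation action -/

section Representations

variable {n : ℕ} {G : Subgroup (GL (Fin n) ℂ)}

/-! Only the image `h` of the Lie algebra in `End V` matters: a bracket-closed space of operators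
skew for `B`. The implications run (1) ⇒ (3) ⇒ (2) ⇒ (1), and reductivity is needed only for the
last.

(1) ⇒ (3). Since `V = V₀ + h v₀`, the map `(Z, u) ↦ exp(Z) u` on `h × V₀` is a submersion at `(0,
v₀)`. Hence translates of `V₀` by isometries normalizing `h` fill a neighbourhood of `v₀`, and a
polynomial function vanishing on all of them is zero (`polyFun_eq_zero_of_isometries`). This is
applied to `Δ(v) B(P y, X (P z))`, where `Δ` is a Gram determinant of tangent vectors at `v` and `P`
is `Δ` times the projection off their span. On `V₀` the vanishing expresses `B(V₀, h V₀) = 0`, and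
isometries transport it. Expanding both copies of `P` writes `Δ² B(y, X z)` through pairings of `y`
and `z` with tangent vectors (`exists_polynomial_relation`); division by `Δ²` gives (3).

(3) ⇒ (2). Clear denominators and evaluate where they do not vanish
(`exists_denominator_of_mem_span`).

(2) ⇒ (1). Take `V₀ = (h v)^⊥` for general `v`; then (2) says `h u ⊆ h v` for all `u ∈ V₀`. The
obstacle is that `B` may degenerate on `h v`. It does not if `v` is real for an orthonormal basis in
which the conjugate transpose of every element of `h` normalizes `h`
(`eq_zero_of_orthogonal_of_real`), and general points can be chosen real. Such a basis comes from a
minimization in the spirit of Kempf and Ness (`exists_frame_conjTranspose_normalizes`): over complex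
orthogonal `g` and equivariant projections `Ω` onto `g h gᵀ`, minimize `‖Ω‖² + ε ‖g‖²` and let `ε →
0`. Stationarity gives the normalization in a bounded limit; escape of `g` to infinity is excluded
by complete reducibility of `V` under `h`. -/

theorem lieAlg_apply_mul (δ : lieAlg G) (f h : coordRing G) :
    (δ : Dual ℂ (coordRing G)) (f * h) =
      (f : G → ℂ) 1 * (δ : Dual ℂ (coordRing G)) h + (h : G → ℂ) 1 * (δ : Dual ℂ (coordRing G)) f :=
  δ.2 f h

theorem lieAlg_apply_one (δ : lieAlg G) : (δ : Dual ℂ (coordRing G)) 1 = 0 := by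
  have h := lieAlg_apply_mul δ 1 1
  simp only [mul_one, OneMemClass.coe_one, Pi.one_apply, one_mul] at h
  linear_combination -h

variable {V W : Type*} [AddCommGroup V] [Module ℂ V] [AddCommGroup W] [Module ℂ W]
  {ρ : Representation ℂ G V} {σ : Representation ℂ G W}

@[simp]
theorem matrixCoeff_apply_apply (hρ : IsAlgebraicRep ρ) (v : V) (l : Dual ℂ V) (g : G) :
    (matrixCoeff hρ v l : G → ℂ) g = l (ρ g v) := rfl

variable [FiniteDimensional ℂ V] [FiniteDimensional ℂ W]

/-- The product rule for a bilinear form evaluated along two algebraic representations. -/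
theorem lieAlg_apply_bilin (hρ : IsAlgebraicRep ρ) (hσ : IsAlgebraicRep σ)
    (β : V →ₗ[ℂ] W →ₗ[ℂ] ℂ) (x : V) (y : W) (f : coordRing G)
    (hf : ∀ g, (f : G → ℂ) g = β (ρ g x) (σ g y)) (δ : lieAlg G) :
    (δ : Dual ℂ (coordRing G)) f =
      β (differential hρ δ x) y + β x (differential hσ δ y) := by
  let e := finBasis ℂ V
  have hβ : ∀ (v : V) (w : W), β v w = ∑ a, e.coord a v * β (e a) w := fun v w => by
    conv_lhs => rw [← e.sum_repr v]
    simp only [map_sum, map_smul, LinearMap.sum_apply, LinearMap.smul_apply, smul_eq_mul,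
      Basis.coord_apply]
  have hsum : f = ∑ a, matrixCoeff hρ x (e.coord a) * matrixCoeff hσ y (β (e a)) := by
    refine Subtype.ext (funext fun g => ?_)
    rw [hf, hβ]
    simp
  rw [hsum, map_sum, hβ (differential hρ δ x), hβ x, ← Finset.sum_add_distrib]
  refine Finset.sum_congr rfl fun a _ => ?_
  rw [lieAlg_apply_mul, apply_differential, apply_differential]
  simp only [matrixCoeff_apply_apply, map_one, Module.End.one_apply]
  ring

/-- An invariant bilinear form is infinitesimally invariant. -/
theorem differential_skew (hρ : IsAlgebraicRep ρ) {B : LinearMap.BilinForm ℂ V}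
    (horth : ∀ (g : G) (x y : V), B (ρ g x) (ρ g y) = B x y) (δ : lieAlg G) (x y : V) :
    B (differential hρ δ x) y + B x (differential hρ δ y) = 0 := by
  rw [← lieAlg_apply_bilin hρ hρ B x y (B x y • 1) (fun g => by simp [horth]) δ, map_smul,
    lieAlg_apply_one, smul_zero]

/-- A subspace stable under the group is stable under its Lie algebra. -/
theorem differential_mem_of_stable (hρ : IsAlgebraicRep ρ) {K : Submodule ℂ V}
    (hK : ∀ g, ∀ x ∈ K, ρ g x ∈ K) (δ : lieAlg G) {x : V} (hx : x ∈ K) :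
    differential hρ δ x ∈ K := by
  by_contra h
  obtain ⟨l, hl, hlK⟩ := Submodule.exists_le_ker_of_notMem h
  apply hl
  have : matrixCoeff hρ x l = 0 := Subtype.ext (funext fun g => hlK (hK g x hx))
  rw [apply_differential, this, map_zero]

variable {B : LinearMap.BilinForm ℂ V}

/-- Conjugation involves `ρ g⁻¹`, whose coefficients must be shown regular. Invariance of `B` moves
`g⁻¹` to the other side, `B y (ρ g⁻¹ x) = B (ρ g y) x`, so they are again matrix coefficients of
`ρ`. -/
theorem isAlgebraicRep_linHom (hρ : IsAlgebraicRep ρ) (hB : B.Nondegenerate)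
    (horth : ∀ (g : G) (x y : V), B (ρ g x) (ρ g y) = B x y) :
    IsAlgebraicRep (ρ.linHom ρ) := by
  intro L f
  let e := finBasis ℂ V
  let E : Fin (finrank ℂ V) → Fin (finrank ℂ V) → End ℂ V := fun k p => (e.coord p).smulRight (e k)
  choose y hy using fun q => (B.toDual hB).surjective (e.coord q)
  have hy' : ∀ q x, e.coord q x = B (y q) x := fun q x => by
    rw [← hy q]; rfl
  have hE : ∀ A : End ℂ V, A = ∑ k, ∑ p, e.coord k (A (e p)) • E k p := by
    intro A
    refine e.ext fun p => ?_
    simp only [E, LinearMap.sum_apply, LinearMap.smul_apply, LinearMap.smulRight_apply,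
      Basis.coord_apply, Basis.repr_self, Finsupp.single_apply, ite_smul, one_smul, zero_smul,
      smul_ite, smul_zero]
    simp [e.sum_repr]
  have hcomp : ∀ (g : G) k p, e.coord k ((ρ.linHom ρ g f) (e p)) =
      ∑ q, e.coord k (ρ g (f (e q))) * B.flip (e p) (ρ g (y q)) := by
    intro g k p
    rw [Representation.linHom_apply, LinearMap.comp_apply, LinearMap.comp_apply]
    conv_lhs => rw [← e.sum_repr (ρ g⁻¹ (e p))]
    simp only [map_sum, map_smul, smul_eq_mul]
    refine Finset.sum_congr rfl fun q _ => ?_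
    rw [mul_comm, ← Basis.coord_apply, hy' q, LinearMap.BilinForm.flip_apply, ← horth g (y q),
      Representation.self_inv_apply]
  have : (fun g : G => L (ρ.linHom ρ g f)) = ∑ k, ∑ p, ∑ q, L (E k p) •
      ((fun g : G => e.coord k (ρ g (f (e q)))) * fun g : G => B.flip (e p) (ρ g (y q))) := by
    funext g
    conv_lhs => rw [hE (ρ.linHom ρ g f)]
    simp only [map_sum, map_smul, smul_eq_mul, hcomp, Finset.sum_apply, Pi.smul_apply, Pi.mul_apply,
      Finset.sum_mul]
    refine Finset.sum_congr rfl fun k _ => Finset.sum_congr rfl fun p _ =>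
      Finset.sum_congr rfl fun q _ => mul_comm _ _
  rw [this]
  exact Subalgebra.sum_mem _ fun k _ => Subalgebra.sum_mem _ fun p _ => Subalgebra.sum_mem _
    fun q _ => Subalgebra.smul_mem _ (mul_mem (hρ _ _) (hρ _ _)) _

/-- Product rule applied to evaluation: `(g · f)(g x) = g (f x)` differentiates to `(δ · f) x + f (δ
x) = δ (f x)`. -/
theorem differential_linHom (hρ : IsAlgebraicRep ρ) (hσ : IsAlgebraicRep (ρ.linHom ρ))
    (δ : lieAlg G) (f : End ℂ V) :
    differential hσ δ f = differential hρ δ * f - f * differential hρ δ := by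
  ext x
  refine sub_eq_zero.1 ((Module.forall_dual_apply_eq_zero_iff ℂ _).1 fun l => ?_)
  have h := lieAlg_apply_bilin hσ hρ ((LinearMap.compr₂ LinearMap.id l)) f x
    (matrixCoeff hρ (f x) l) (fun g => by simp [Representation.linHom_apply]) δ
  rw [← apply_differential] at h
  simp only [LinearMap.compr₂_apply, LinearMap.id_apply] at h
  simp [h]

/-- The entries of `g x g⁻¹` are linear in those of `x`, and the determinant is unchanged. -/
theorem conj_mem_coordRing (g : G) {f : G → ℂ} (hf : f ∈ coordRing G) :
    (fun x => f (g * x * g⁻¹)) ∈ coordRing G := by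
  let c : (G → ℂ) →ₐ[ℂ] (G → ℂ) := 
    { toFun := fun f x => f (g * x * g⁻¹)
      map_one' := rfl
      map_mul' := fun _ _ => rfl
      map_zero' := rfl
      map_add' := fun _ _ => rfl
      commutes' := fun _ => rfl }
  have hc : ∀ f x, c f x = f (g * x * g⁻¹) := fun _ _ => rfl
  have h : coordRing G ≤ (coordRing G).comap c := by
    refine Algebra.adjoin_le ?_
    rintro f (⟨ij, rfl⟩ | hf)
    · have : c (fun g : G => entries (g : GL (Fin n) ℂ) ij) = ∑ k, ∑ l,
          (entries (g : GL (Fin n) ℂ) (ij.1, k) * entries ((g⁻¹ : G) : GL (Fin n) ℂ) (l, ij.2)) •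
            fun x : G => entries (x : GL (Fin n) ℂ) (k, l) := by
        funext x
        rw [hc]
        simp only [entries, Finset.sum_apply, Pi.smul_apply, smul_eq_mul, Subgroup.coe_mul,
          Units.val_mul, Matrix.mul_apply, Finset.sum_mul]
        rw [Finset.sum_comm]
        refine Finset.sum_congr rfl fun k _ => Finset.sum_congr rfl fun l _ => by ring
      rw [SetLike.mem_coe, Subalgebra.mem_comap, this]
      refine Subalgebra.sum_mem _ fun k _ => Subalgebra.sum_mem _ fun l _ =>
        Subalgebra.smul_mem _ ?_ _
      exact Algebra.subset_adjoin (Or.inl ⟨(k, l), rfl⟩)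
    · have : c f = f := by
        rw [Set.mem_singleton_iff.1 hf]
        funext x
        have hg : ((g : GL (Fin n) ℂ) : Matrix (Fin n) (Fin n) ℂ).det *
            (((g⁻¹ : G) : GL (Fin n) ℂ) : Matrix (Fin n) (Fin n) ℂ).det = 1 := by
          rw [← Matrix.det_mul, ← Units.val_mul, ← Subgroup.coe_mul]
          simp
        rw [hc, Subgroup.coe_mul, Subgroup.coe_mul, Units.val_mul, Units.val_mul, Matrix.det_mul,
          Matrix.det_mul, mul_right_comm, hg, one_mul]
      rw [SetLike.mem_coe, Subalgebra.mem_comap, this]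
      exact Algebra.subset_adjoin (Or.inr hf)
  exact h hf

/-- The image of the Lie algebra is stable under conjugation by the group. -/
theorem linHom_mem_range_differential (hρ : IsAlgebraicRep ρ) (g : G) {X : End ℂ V}
    (hX : X ∈ LinearMap.range (differential hρ)) :
    ρ.linHom ρ g X ∈ LinearMap.range (differential hρ) := by
  obtain ⟨δ, rfl⟩ := hX
  let c : coordRing G →ₗ[ℂ] coordRing G :=
    { toFun := fun f => ⟨fun x => (f : G → ℂ) (g * x * g⁻¹), conj_mem_coordRing g f.2⟩
      map_add' := fun _ _ => rfl
      map_smul' := fun _ _ => rfl }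
  have hc : ∀ f h, c (f * h) = c f * c h := fun _ _ => rfl
  have hc1 : ∀ f, (c f : G → ℂ) 1 = (f : G → ℂ) 1 := fun f => by simp [c]
  refine ⟨⟨(δ : Dual ℂ (coordRing G)) ∘ₗ c, fun f h => ?_⟩, ?_⟩
  · simp only [LinearMap.comp_apply, hc, lieAlg_apply_mul, hc1]
  · ext x
    refine sub_eq_zero.1 ((Module.forall_dual_apply_eq_zero_iff ℂ _).1 fun l => ?_)
    rw [map_sub, sub_eq_zero, apply_differential, Representation.linHom_apply]
    show (δ : Dual ℂ (coordRing G)) (c _) = (l ∘ₗ ρ g) (differential hρ δ (ρ g⁻¹ x))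
    rw [apply_differential]
    congr 1
    refine Subtype.ext (funext fun y => ?_)
    simp [c, map_mul]

end Representations

/-! ### Complete reducibility passes from the group to its Lie algebra -/

section Semisimple

variable {n : ℕ} {G : Subgroup (GL (Fin n) ℂ)}
  {V : Type*} [AddCommGroup V] [Module ℂ V] [FiniteDimensional ℂ V] {ρ : Representation ℂ G V}

/-- In an algebraic representation of a reductive group every stable subspace has a stable
complement. -/
theorem IsReductive.exists_isCompl (hG : IsReductive G) (hρ : IsAlgebraicRep ρ)
    {K : Submodule ℂ V} (hK : ∀ g, ∀ x ∈ K, ρ g x ∈ K) :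
    ∃ C : Submodule ℂ V, IsCompl K C ∧ ∀ g, ∀ x ∈ C, ρ g x ∈ C := by
  -- Reductivity is formulated for coordinate spaces only, so the representation is transported to
  -- one.
  let e : V ≃ₗ[ℂ] (Fin (finrank ℂ V) → ℂ) := (finBasis ℂ V).equivFun
  let σ : Representation ℂ G (Fin (finrank ℂ V) → ℂ) :=
    { toFun := fun g => e.conj (ρ g)
      map_one' := by ext; simp
      map_mul' := fun g h => by ext; simp }
  have hσ' : ∀ g x, σ g x = e (ρ g (e.symm x)) := fun g x => rfl
  have hσ : IsAlgebraicRep σ := fun l v => hρ (l ∘ₗ e.toLinearMap) (e.symm v)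
  have hss := hG.2 _ σ hσ
  let K' : Subrepresentation σ := ⟨K.map e.toLinearMap, by
    rintro g _ ⟨x, hx, rfl⟩
    exact ⟨ρ g x, hK g x hx, by simp [hσ']⟩⟩
  obtain ⟨C, hC⟩ := hss.exists_isCompl K'
  have hC' : IsCompl K'.toSubmodule C.toSubmodule := by
    refine ⟨disjoint_iff.2 ?_, codisjoint_iff.2 ?_⟩
    · rw [← Subrepresentation.toSubmodule_inf, hC.inf_eq_bot]; rfl
    · rw [← Subrepresentation.toSubmodule_sup, hC.sup_eq_top]; rfl
  refine ⟨C.toSubmodule.comap e.toLinearMap, ?_, fun g x hx => ?_⟩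
  · have := hC'.map (Submodule.orderIsoMapComap e).symm
    have h2 : (Submodule.orderIsoMapComap e).symm K'.toSubmodule = K :=
      (Submodule.orderIsoMapComap e).symm_apply_apply K
    rw [h2] at this
    exact this
  · have := C.apply_mem_toSubmodule g hx
    rw [hσ'] at this
    simpa using this

variable {B : LinearMap.BilinForm ℂ V}

/-- The image of the Lie algebra is closed under the bracket. -/
theorem commutator_mem_range_differential (hρ : IsAlgebraicRep ρ) (hB : B.Nondegenerate)
    (horth : ∀ (g : G) (x y : V), B (ρ g x) (ρ g y) = B x y) {X Y : End ℂ V}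
    (hX : X ∈ LinearMap.range (differential hρ)) (hY : Y ∈ LinearMap.range (differential hρ)) :
    X * Y - Y * X ∈ LinearMap.range (differential hρ) := by
  obtain ⟨δ, rfl⟩ := hX
  have hσ := isAlgebraicRep_linHom hρ hB horth
  rw [← differential_linHom hρ hσ]
  exact differential_mem_of_stable hσ (fun g x hx => linHom_mem_range_differential hρ g hx) δ hY

/-- The image of the Lie algebra has a complement stable under the adjoint action. -/
theorem IsReductive.exists_isCompl_range (hG : IsReductive G) (hρ : IsAlgebraicRep ρ)
    (hB : B.Nondegenerate) (horth : ∀ (g : G) (x y : V), B (ρ g x) (ρ g y) = B x y) :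
    ∃ C : Submodule ℂ (End ℂ V), IsCompl (LinearMap.range (differential hρ)) C ∧
      ∀ X ∈ LinearMap.range (differential hρ), ∀ Y ∈ C, X * Y - Y * X ∈ C := by
  have hσ := isAlgebraicRep_linHom hρ hB horth
  obtain ⟨C, hC, hstab⟩ :=
    hG.exists_isCompl hσ (fun g x hx => linHom_mem_range_differential hρ g hx)
  refine ⟨C, hC, ?_⟩
  rintro _ ⟨δ, rfl⟩ Y hY
  rw [← differential_linHom hρ hσ]
  exact differential_mem_of_stable hσ hstab δ hY

/-- A subspace stable under a set of operators, as a module over the algebra they generate. -/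
def stableSubmodule (S : Set (End ℂ V)) (K : Submodule ℂ V) (hK : ∀ X ∈ S, ∀ x ∈ K, X x ∈ K) :
    Submodule (Algebra.adjoin ℂ S) V :=
  { K with
    smul_mem' := by
      rintro ⟨a, ha⟩ x hx
      show a x ∈ K
      induction ha using Algebra.adjoin_induction generalizing x with
      | mem X hX => exact hK X hX x hx
      | algebraMap r => exact K.smul_mem r hx
      | add a b _ _ iha ihb => exact K.add_mem (iha hx) (ihb hx)
      | mul a b _ _ iha ihb => exact iha (ihb hx) }

/-- An algebraic representation of a reductive group is completely reducible under the Lie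
algebra. -/
theorem IsReductive.exists_isCompl_of_differential (hG : IsReductive G) (hρ : IsAlgebraicRep ρ)
    {K : Submodule ℂ V} (hK : ∀ X ∈ LinearMap.range (differential hρ), ∀ x ∈ K, X x ∈ K) :
    ∃ C : Submodule ℂ V, IsCompl K C ∧
      ∀ X ∈ LinearMap.range (differential hρ), ∀ x ∈ C, X x ∈ C := by
  let S : Set (End ℂ V) := LinearMap.range (differential hρ)
  let A := Algebra.adjoin ℂ S
  have hS : ∀ (N : Submodule A V), ∀ X ∈ S, ∀ x ∈ N, X x ∈ N := fun N X hX x hx =>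
    N.smul_mem (⟨X, Algebra.subset_adjoin hX⟩ : A) hx
  -- The group normalizes `S`, so it permutes the `A`-submodules. This allows a Clifford-type
  -- argument valid for disconnected groups.
  have hmap : ∀ (g : G) (N : Submodule A V), ∀ X ∈ S,
      ∀ x ∈ (N.restrictScalars ℂ).map (ρ g), X x ∈ (N.restrictScalars ℂ).map (ρ g) := by
    rintro g N X hX _ ⟨x, hx, rfl⟩
    refine ⟨ρ.linHom ρ g⁻¹ X x, hS N _ (linHom_mem_range_differential hρ g⁻¹ hX) x hx, ?_⟩
    simp [Representation.linHom_apply]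
  let act : G → Submodule A V → Submodule A V := fun g N =>
    stableSubmodule S ((N.restrictScalars ℂ).map (ρ g)) (hmap g N)
  have hact : ∀ g N x, x ∈ act g N ↔ ρ g⁻¹ x ∈ N := by
    refine fun g N x => ⟨?_, fun h => ⟨_, h, by simp⟩⟩
    rintro ⟨y, hy, rfl⟩
    simpa using hy
  let iso : G → (Submodule A V ≃o Submodule A V) := fun g =>
    { toFun := act g
      invFun := act g⁻¹
      left_inv := fun N => by ext x; simp [hact]
      right_inv := fun N => by ext x; simp [hact]
      map_rel_iff' := fun {N N'} => by
        refine ⟨fun h x hx => ?_, fun h x hx => (hact _ _ _).2 (h ((hact _ _ _).1 hx))⟩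
        have := (hact g N' (ρ g x)).1 (h ((hact g N (ρ g x)).2 (by simpa using hx)))
        simpa using this }
  -- The socle: an order automorphism permutes the atoms, so `T` is stable under the group.
  let T : Submodule A V := sSup {a | IsAtom a}
  have hT : ∀ g, ∀ x ∈ T.restrictScalars ℂ, ρ g x ∈ T.restrictScalars ℂ := by
    intro g x hx
    have h1 : iso g T ≤ T := by
      rw [(iso g).map_sSup]
      exact iSup₂_le fun a ha => le_sSup ((iso g).isAtom_iff a |>.2 ha)
    exact h1 ((hact g T (ρ g x)).2 (by simpa using hx))
  obtain ⟨C, hC, hCs⟩ := hG.exists_isCompl hρ hT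
  let C' : Submodule A V := stableSubmodule S C (by
    rintro _ ⟨δ, rfl⟩ x hx
    exact differential_mem_of_stable hρ hCs δ hx)
  have : IsArtinian A V := isArtinian_of_tower ℂ inferInstance
  -- A nonzero `C'` would contain a simple submodule, which lies in the socle and hence in `T ∩ C =
  -- 0`.
  have hC' : C' = ⊥ := by
    refine (eq_bot_or_exists_atom_le C').resolve_right ?_
    rintro ⟨a, ha, haC⟩
    refine ha.1 ((Submodule.eq_bot_iff _).2 fun x hx => ?_)
    have h1 : x ∈ T := (le_sSup (s := {a | IsAtom a}) ha) hx
    exact (Submodule.mem_bot ℂ).1 (hC.disjoint.le_bot ⟨h1, haC hx⟩)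
  have hTtop : T = ⊤ := by
    refine eq_top_iff.2 fun x _ => ?_
    have hCbot : C = ⊥ := (Submodule.eq_bot_iff _).2 fun y hy =>
      (Submodule.mem_bot A).1 (hC' ▸ (show y ∈ C' from hy))
    have := hC.sup_eq_top
    rw [hCbot, sup_bot_eq] at this
    exact (show x ∈ T.restrictScalars ℂ from this ▸ Submodule.mem_top)
  have := complementedLattice_of_sSup_atoms_eq_top hTtop
  obtain ⟨D, hD⟩ := ComplementedLattice.exists_isCompl (stableSubmodule S K hK)
  refine ⟨D.restrictScalars ℂ, ⟨?_, ?_⟩, hS D⟩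
  · refine Submodule.disjoint_def.2 fun x hx hxD => ?_
    exact Submodule.disjoint_def.1 hD.disjoint x hx hxD
  · refine codisjoint_iff.2 (eq_top_iff.2 fun x _ => ?_)
    obtain ⟨y, hy, z, hz, rfl⟩ := Submodule.mem_sup.1
      (show x ∈ stableSubmodule S K hK ⊔ D from hD.sup_eq_top ▸ Submodule.mem_top)
    exact Submodule.mem_sup.2 ⟨y, hy, z, hz, rfl⟩

end Semisimple

end PolarRep

namespace PolarRep

/-! ### First variation of the norm on pairs of a frame and a projection -/

section MinimalFrame

open Matrix Filter Topology
open scoped Kronecker Matrix.Norms.Frobenius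

theorem continuous_kronecker_self {ι : Type*} :
    Continuous fun g : Matrix ι ι ℂ => g ⊗ₖ g := by
  refine continuous_matrix fun i j => ?_
  exact (continuous_id.matrix_elem _ _).mul (continuous_id.matrix_elem _ _)

variable {ι : Type*} [DecidableEq ι]

/-- The infinitesimal action on a Kronecker square. -/
def kroneckerDeriv (X : Matrix ι ι ℂ) : Matrix (ι × ι) (ι × ι) ℂ := X ⊗ₖ 1 + 1 ⊗ₖ X

theorem kroneckerDeriv_conjTranspose (X : Matrix ι ι ℂ) :
    kroneckerDeriv Xᴴ = (kroneckerDeriv X)ᴴ := by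
  simp [kroneckerDeriv, conjTranspose_kronecker]

theorem kroneckerDeriv_transpose (X : Matrix ι ι ℂ) :
    (kroneckerDeriv X)ᵀ = kroneckerDeriv Xᵀ := by
  simp [kroneckerDeriv, ← kroneckerMap_transpose]

theorem kroneckerDeriv_neg (X : Matrix ι ι ℂ) : kroneckerDeriv (-X) = -kroneckerDeriv X := by
  ext ⟨i, j⟩ ⟨k, l⟩
  simp [kroneckerDeriv, kroneckerMap_apply]
  ring

variable [Fintype ι]

theorem frobenius_norm_sq (A : Matrix ι ι ℂ) : ‖A‖ ^ 2 = (A * Aᴴ).trace.re := by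
  rw [frobenius_norm_def, ← Real.sqrt_eq_rpow, Real.sq_sqrt (by positivity)]
  simp only [trace, diag_apply, mul_apply, conjTranspose_apply, Complex.re_sum]
  refine Finset.sum_congr rfl fun i _ => Finset.sum_congr rfl fun j _ => ?_
  rw [Complex.star_def, Complex.mul_conj, Complex.ofReal_re, Complex.normSq_eq_norm_sq]
  norm_cast

theorem hasDerivAt_frobenius_norm_sq {A : ℝ → Matrix ι ι ℂ} {A' : Matrix ι ι ℂ} {t : ℝ}
    (h : HasDerivAt A A' t) :
    HasDerivAt (fun s => ‖A s‖ ^ 2) (2 * (A' * (A t)ᴴ).trace.re) t := by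
  let T : Matrix ι ι ℂ →ₗ[ℝ] ℝ := Complex.reLm ∘ₗ traceLinearMap ι ℝ ℂ
  have h1 := (LinearMap.toContinuousLinearMap T).hasFDerivAt.comp_hasDerivAt t (h.mul h.star)
  have h2 : (fun s => ‖A s‖ ^ 2) = T ∘ (A * fun s => star (A s)) := by
    funext s
    exact frobenius_norm_sq (A s)
  rw [h2]
  refine h1.congr_deriv ?_
  have h3 : (A t * A'ᴴ).trace.re = (A' * (A t)ᴴ).trace.re := by
    have : A t * A'ᴴ = (A' * (A t)ᴴ)ᴴ := by simp
    rw [this, trace_conjTranspose, Complex.star_def, Complex.conj_re]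
  show (A' * (A t)ᴴ + A t * A'ᴴ).trace.re = _
  rw [trace_add, Complex.add_re, h3, two_mul]

theorem hasDerivAt_exp_smul_zero (H : Matrix ι ι ℂ) :
    HasDerivAt (fun t : ℝ => NormedSpace.exp (t • H)) H 0 := by
  refine (hasDerivAt_exp_smul_const (𝕂 := ℝ) H 0).congr_deriv ?_
  rw [zero_smul, NormedSpace.exp_zero, one_mul]

theorem hasDerivAt_kronecker_self {A : ℝ → Matrix ι ι ℂ} {X : Matrix ι ι ℂ}
    (h : HasDerivAt A X 0) (h0 : A 0 = 1) :
    HasDerivAt (fun s => A s ⊗ₖ A s) (kroneckerDeriv X) 0 := by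
  let P : Matrix ι ι ℂ →ₗ[ℝ] Matrix (ι × ι) (ι × ι) ℂ := (kroneckerBilinear (R := ℝ)).flip 1
  let Q : Matrix ι ι ℂ →ₗ[ℝ] Matrix (ι × ι) (ι × ι) ℂ := kroneckerBilinear (R := ℝ) 1
  have hP := (LinearMap.toContinuousLinearMap P).hasFDerivAt.comp_hasDerivAt 0 h
  have hQ := (LinearMap.toContinuousLinearMap Q).hasFDerivAt.comp_hasDerivAt 0 h
  have hPQ := hP.mul hQ
  have h2 : (fun s => A s ⊗ₖ A s) = (P ∘ A) * (Q ∘ A) := by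
    funext s
    show A s ⊗ₖ A s = (A s ⊗ₖ (1 : Matrix ι ι ℂ)) * ((1 : Matrix ι ι ℂ) ⊗ₖ A s)
    rw [← mul_kronecker_mul, mul_one, one_mul]
  rw [h2]
  refine hPQ.congr_deriv ?_
  show (X ⊗ₖ (1 : Matrix ι ι ℂ)) * ((1 : Matrix ι ι ℂ) ⊗ₖ A 0) +
    (A 0 ⊗ₖ (1 : Matrix ι ι ℂ)) * ((1 : Matrix ι ι ℂ) ⊗ₖ X) = _
  rw [h0, ← mul_kronecker_mul, ← mul_kronecker_mul]
  simp [kroneckerDeriv]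

theorem kroneckerDeriv_commutator (X Y : Matrix ι ι ℂ) :
    kroneckerDeriv (X * Y - Y * X) =
      kroneckerDeriv X * kroneckerDeriv Y - kroneckerDeriv Y * kroneckerDeriv X := by
  have h1 : ∀ A B : Matrix ι ι ℂ, (A - B) ⊗ₖ (1 : Matrix ι ι ℂ) = A ⊗ₖ 1 - B ⊗ₖ 1 := fun A B => by
    ext ⟨i, j⟩ ⟨k, l⟩
    simp [kroneckerMap_apply, sub_mul]
  have h2 : ∀ A B : Matrix ι ι ℂ, (1 : Matrix ι ι ℂ) ⊗ₖ (A - B) = 1 ⊗ₖ A - 1 ⊗ₖ B := fun A B => by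
    ext ⟨i, j⟩ ⟨k, l⟩
    simp [kroneckerMap_apply, mul_sub]
  simp only [kroneckerDeriv, mul_add, add_mul, ← mul_kronecker_mul, mul_one, one_mul, h1, h2]
  abel

/-- Vectorization turns `g ⊗ g` into `Y ↦ g Y gᵀ`, which is conjugation when `g` is orthogonal; its
derivative in a skew direction is the adjoint action. -/
theorem kroneckerDeriv_mulVec_vec {X : Matrix ι ι ℂ} (hX : Xᵀ = -X) (Y : Matrix ι ι ℂ) :
    kroneckerDeriv X *ᵥ vec Y = vec (X * Y - Y * X) := by
  rw [kroneckerDeriv, add_mulVec, kronecker_mulVec_vec, kronecker_mulVec_vec, hX, ← vec_add]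
  congr 1
  simp [sub_eq_neg_add]

theorem kronecker_self_mul_kroneckerDeriv {g X Y : Matrix ι ι ℂ} (h : g * X = Y * g) :
    (g ⊗ₖ g) * kroneckerDeriv X = kroneckerDeriv Y * (g ⊗ₖ g) := by
  simp only [kroneckerDeriv, mul_add, add_mul, ← mul_kronecker_mul, mul_one, one_mul, h]

/-- A Jacobi identity under the trace. With `b` and `v` the conjugate transposes of `a` and `w`, the
right side is the squared norm of `[b, w]`; this is how a first derivative becomes a square. -/
theorem trace_commutator_commutator {κ : Type*} [Fintype κ] {a b w v : Matrix κ κ ℂ}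
    (h : a * w = w * a) :
    (((a * b - b * a) * w - w * (a * b - b * a)) * v).trace =
      ((b * w - w * b) * (v * a - a * v)).trace := by
  have h1 : ((a * b - b * a) * w - w * (a * b - b * a)) * v =
      a * ((b * w - w * b) * v) - (b * w - w * b) * (a * v) := by
    have h2 : w * (a * b) = a * (w * b) := by rw [← mul_assoc, ← h, mul_assoc]
    have h3 : b * a * w = b * (w * a) := by rw [mul_assoc, h]
    simp only [sub_mul, mul_sub, h2, h3]
    noncomm_ring
  rw [h1, trace_sub, trace_mul_comm, mul_sub, trace_sub, mul_assoc]

variable (h : Submodule ℂ (Matrix ι ι ℂ))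

/-- The projections onto `h` that commute with the adjoint action of `h`, as matrices acting on
vectorised matrices. -/
def equivariantProjections : Set (Matrix (ι × ι) (ι × ι) ℂ) :=
  {w | (∀ Y ∈ h, w *ᵥ vec Y = vec Y) ∧ (∀ y, ∃ Y ∈ h, w *ᵥ y = vec Y) ∧
    ∀ X ∈ h, kroneckerDeriv X * w = w * kroneckerDeriv X}

/-- Pairs of an orthogonal matrix `g` and an equivariant projection onto `g h gᵀ`. -/
def framePairs : Set (Matrix ι ι ℂ × Matrix (ι × ι) (ι × ι) ℂ) :=
  {p | p.1ᵀ * p.1 = 1 ∧ (p.1 ⊗ₖ p.1)ᵀ * p.2 * (p.1 ⊗ₖ p.1) ∈ equivariantProjections h}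

theorem isClosed_equivariantProjections : IsClosed (equivariantProjections h) := by
  let vecL : Matrix ι ι ℂ →ₗ[ℂ] (ι × ι → ℂ) :=
    { toFun := vec, map_add' := fun _ _ => rfl, map_smul' := fun _ _ => rfl }
  have hc : ∀ y : ι × ι → ℂ, Continuous fun w : Matrix (ι × ι) (ι × ι) ℂ => w *ᵥ y := fun y =>
    continuous_id.matrix_mulVec continuous_const
  have h1 : IsClosed {w : Matrix (ι × ι) (ι × ι) ℂ | ∀ Y ∈ h, w *ᵥ vec Y = vec Y} := by
    simp only [Set.ofPred_forall]
    exact isClosed_biInter fun Y _ => isClosed_eq (hc _) continuous_const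
  have h2 : IsClosed {w : Matrix (ι × ι) (ι × ι) ℂ | ∀ y, ∃ Y ∈ h, w *ᵥ y = vec Y} := by
    simp only [Set.ofPred_forall]
    refine isClosed_iInter fun y => ?_
    have := (Submodule.closed_of_finiteDimensional (h.map vecL)).preimage (hc y)
    convert this using 1
    ext w
    simp only [Set.mem_ofPred_eq, Set.mem_preimage, SetLike.mem_coe, Submodule.mem_map]
    exact exists_congr fun Y => and_congr_right fun _ => eq_comm
  have h3 : IsClosed {w : Matrix (ι × ι) (ι × ι) ℂ |
      ∀ X ∈ h, kroneckerDeriv X * w = w * kroneckerDeriv X} := by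
    simp only [Set.ofPred_forall]
    exact isClosed_biInter fun X _ => isClosed_eq (continuous_const.mul continuous_id)
      (continuous_id.mul continuous_const)
  exact h1.inter (h2.inter h3)

theorem isClosed_framePairs : IsClosed (framePairs h) := by
  refine (isClosed_eq (continuous_fst.matrix_transpose.mul continuous_fst)
    continuous_const).inter ?_
  have hk : Continuous fun p : Matrix ι ι ℂ × Matrix (ι × ι) (ι × ι) ℂ => p.1 ⊗ₖ p.1 :=
    continuous_kronecker_self.comp continuous_fst
  exact (isClosed_equivariantProjections h).preimage
    ((hk.matrix_transpose.mul continuous_snd).mul hk)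

/-- The `ε` term is what bounds `g` on sublevel sets, since the complex orthogonal group is not
compact; closedness of the set of pairs then gives a minimizer. -/
theorem exists_minimal_framePair {ε : ℝ} (hε : 0 < ε) (hne : (framePairs h).Nonempty) :
    ∃ p ∈ framePairs h, ∀ q ∈ framePairs h,
      ‖p.2‖ ^ 2 + ε * ‖p.1‖ ^ 2 ≤ ‖q.2‖ ^ 2 + ε * ‖q.1‖ ^ 2 := by
  obtain ⟨p₀, hp₀⟩ := hne
  let Φ : Matrix ι ι ℂ × Matrix (ι × ι) (ι × ι) ℂ → ℝ := fun p => ‖p.2‖ ^ 2 + ε * ‖p.1‖ ^ 2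
  have hΦ : Continuous Φ := by fun_prop
  have : ProperSpace (Matrix ι ι ℂ × Matrix (ι × ι) (ι × ι) ℂ) := FiniteDimensional.proper ℂ _
  have hcl : IsClosed (framePairs h ∩ {p | Φ p ≤ Φ p₀}) :=
    (isClosed_framePairs h).inter (isClosed_le hΦ continuous_const)
  have hbd : Bornology.IsBounded (framePairs h ∩ {p | Φ p ≤ Φ p₀}) := by
    refine (isBounded_iff_forall_norm_le).2
      ⟨max (Real.sqrt (Φ p₀ / ε)) (Real.sqrt (Φ p₀)), fun p hp => ?_⟩
    have hp2 : ‖p.2‖ ^ 2 + ε * ‖p.1‖ ^ 2 ≤ Φ p₀ := hp.2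
    refine max_le_max ?_ ?_
    · refine Real.le_sqrt_of_sq_le ((le_div_iff₀ hε).2 ?_)
      nlinarith [sq_nonneg ‖p.2‖]
    · refine Real.le_sqrt_of_sq_le ?_
      have : 0 ≤ ε * ‖p.1‖ ^ 2 := by positivity
      linarith
  obtain ⟨p, hp, hmin⟩ := (Metric.isCompact_of_isClosed_isBounded hcl hbd).exists_isMinOn
    ⟨p₀, hp₀, le_refl (Φ p₀)⟩ hΦ.continuousOn
  refine ⟨p, hp.1, fun q hq => ?_⟩
  by_cases hqp : Φ q ≤ Φ p₀
  · exact hmin ⟨hq, hqp⟩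
  · exact hp.2.trans (not_le.1 hqp).le

variable {h}

theorem exp_smul_transpose_mul {H : Matrix ι ι ℂ} (hH : Hᵀ = -H) (t : ℝ) :
    (NormedSpace.exp (t • H))ᵀ * NormedSpace.exp (t • H) = 1 := by
  rw [← exp_transpose, transpose_smul, hH, smul_neg, exp_neg]
  exact nonsing_inv_mul _ ((isUnit_iff_isUnit_det _).1 (isUnit_exp _))

/-- Vary along `exp(tH)` with `H = [X, Xᴴ]`, which is skew, so the curve stays among the admissible
pairs. As `X` commutes with `Ω`, the derivative of `‖Ω‖²` in this direction is twice the squared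
norm of `[Xᴴ, Ω]`. -/
theorem minimal_framePair_left {ε : ℝ} {g : Matrix ι ι ℂ} {Ω : Matrix (ι × ι) (ι × ι) ℂ}
    (hp : (g, Ω) ∈ framePairs h)
    (hmin : ∀ q ∈ framePairs h, ‖Ω‖ ^ 2 + ε * ‖g‖ ^ 2 ≤ ‖q.2‖ ^ 2 + ε * ‖q.1‖ ^ 2)
    {X : Matrix ι ι ℂ} (hX : Xᵀ = -X) (hXΩ : kroneckerDeriv X * Ω = Ω * kroneckerDeriv X) :
    ‖kroneckerDeriv Xᴴ * Ω - Ω * kroneckerDeriv Xᴴ‖ ^ 2 +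
      ε * ((X * Xᴴ - Xᴴ * X) * g * gᴴ).trace.re = 0 := by
  set H := X * Xᴴ - Xᴴ * X with hHdef
  have hXs : Xᴴᵀ = -Xᴴ := by
    rw [← conjTranspose_transpose_eq_transpose_conjTranspose, hX, conjTranspose_neg]
  have hH : Hᵀ = -H := by
    rw [hHdef, transpose_sub, transpose_mul, transpose_mul, hX, hXs]
    simp
  let A : ℝ → Matrix ι ι ℂ := fun t => NormedSpace.exp (t • H)
  have hA : HasDerivAt A H 0 := hasDerivAt_exp_smul_zero H
  have hA0 : A 0 = 1 := by simp [A]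
  have hAt : ∀ t, (A t)ᵀ * A t = 1 := exp_smul_transpose_mul hH
  let R : ℝ → Matrix (ι × ι) (ι × ι) ℂ := fun t => A t ⊗ₖ A t
  have hR : HasDerivAt R (kroneckerDeriv H) 0 := hasDerivAt_kronecker_self hA hA0
  have hR0 : R 0 = 1 := by simp [R, hA0]
  have hRt : ∀ t, (R t)ᵀ * R t = 1 := fun t => by
    simp only [R, ← kroneckerMap_transpose, ← mul_kronecker_mul, hAt, one_kronecker_one]
  let T : Matrix (ι × ι) (ι × ι) ℂ →ₗ[ℝ] Matrix (ι × ι) (ι × ι) ℂ :=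
    (transposeLinearEquiv (ι × ι) (ι × ι) ℝ ℂ).toLinearMap
  have hRT : HasDerivAt (fun t => (R t)ᵀ) (kroneckerDeriv H)ᵀ 0 :=
    (LinearMap.toContinuousLinearMap T).hasFDerivAt.comp_hasDerivAt 0 hR
  have hmem : ∀ t, (A t * g, R t * Ω * (R t)ᵀ) ∈ framePairs h := by
    intro t
    refine ⟨?_, ?_⟩
    · show (A t * g)ᵀ * (A t * g) = 1
      rw [transpose_mul, mul_assoc, ← mul_assoc _ (A t), hAt, one_mul]
      exact hp.1
    · show ((A t * g) ⊗ₖ (A t * g))ᵀ * (R t * Ω * (R t)ᵀ) * ((A t * g) ⊗ₖ (A t * g)) ∈ _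
      have h1 : (A t * g) ⊗ₖ (A t * g) = R t * (g ⊗ₖ g) := mul_kronecker_mul _ _ _ _
      have h2 : ((A t * g) ⊗ₖ (A t * g))ᵀ * (R t * Ω * (R t)ᵀ) * ((A t * g) ⊗ₖ (A t * g)) =
          (g ⊗ₖ g)ᵀ * (((R t)ᵀ * R t) * Ω * ((R t)ᵀ * R t)) * (g ⊗ₖ g) := by
        rw [h1, transpose_mul]; simp only [mul_assoc]
      rw [h2, hRt, one_mul, mul_one]
      exact hp.2
  have hd : HasDerivAt (fun t => ‖R t * Ω * (R t)ᵀ‖ ^ 2 + ε * ‖A t * g‖ ^ 2)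
      (2 * ((kroneckerDeriv H * Ω - Ω * kroneckerDeriv H) * Ωᴴ).trace.re +
        ε * (2 * (H * g * gᴴ).trace.re)) 0 := by
    have h1 := hasDerivAt_frobenius_norm_sq ((hR.mul_const Ω).mul hRT)
    have h2 := (hasDerivAt_frobenius_norm_sq (hA.mul_const g)).const_mul ε
    refine (h1.add h2).congr_deriv ?_
    rw [hA0, kroneckerDeriv_transpose, hH, kroneckerDeriv_neg]
    simp [sub_eq_add_neg, hR0]
  have hloc : IsLocalMin (fun t => ‖R t * Ω * (R t)ᵀ‖ ^ 2 + ε * ‖A t * g‖ ^ 2) 0 :=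
    Eventually.of_forall fun t => by
      have := hmin _ (hmem t)
      simpa [hR0, hA0] using this
  have hzero := hloc.hasDerivAt_eq_zero hd
  rw [hHdef, kroneckerDeriv_commutator, trace_commutator_commutator hXΩ] at hzero
  have hct : Ωᴴ * kroneckerDeriv X - kroneckerDeriv X * Ωᴴ =
      (kroneckerDeriv Xᴴ * Ω - Ω * kroneckerDeriv Xᴴ)ᴴ := by
    rw [kroneckerDeriv_conjTranspose]; simp
  rw [hct, ← frobenius_norm_sq] at hzero
  linarith

/-- Vary `g` to `g exp(tZ)` with `Ω` fixed. Because `exp(tZ)` centralizes `h`, the pair stays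
admissible, and only the `ε` term of the functional moves. -/
theorem minimal_framePair_right {ε : ℝ} {g : Matrix ι ι ℂ} {Ω : Matrix (ι × ι) (ι × ι) ℂ}
    (hp : (g, Ω) ∈ framePairs h)
    (hmin : ∀ q ∈ framePairs h, ‖Ω‖ ^ 2 + ε * ‖g‖ ^ 2 ≤ ‖q.2‖ ^ 2 + ε * ‖q.1‖ ^ 2)
    {Z : Matrix ι ι ℂ} (hZ : Zᵀ = -Z) (hZh : ∀ X ∈ h, Z * X = X * Z) :
    ε * (g * Z * gᴴ).trace.re = 0 := by
  let A : ℝ → Matrix ι ι ℂ := fun t => NormedSpace.exp (t • Z)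
  have hA : HasDerivAt A Z 0 := hasDerivAt_exp_smul_zero Z
  have hA0 : A 0 = 1 := by simp [A]
  have hAt : ∀ t, (A t)ᵀ * A t = 1 := exp_smul_transpose_mul hZ
  have hAt' : ∀ t, A t * (A t)ᵀ = 1 := fun t => mul_eq_one_comm.1 (hAt t)
  have hcomm : ∀ t, ∀ X ∈ h, A t * X = X * A t := fun t X hX =>
    (Commute.exp_left (show Commute (t • Z) X from (show Commute Z X from hZh X hX).smul_left t)).eq
  have hcommT : ∀ t, ∀ X ∈ h, (A t)ᵀ * X = X * (A t)ᵀ := fun t X hX => by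
    calc (A t)ᵀ * X = (A t)ᵀ * (X * A t) * (A t)ᵀ := by rw [mul_assoc, mul_assoc, hAt', mul_one]
      _ = X * (A t)ᵀ := by rw [← hcomm t X hX, ← mul_assoc, hAt, one_mul]
  have hmem : ∀ t, (g * A t, Ω) ∈ framePairs h := by
    intro t
    refine ⟨?_, ?_⟩
    · show (g * A t)ᵀ * (g * A t) = 1
      rw [transpose_mul, mul_assoc, ← mul_assoc _ g, hp.1, one_mul, hAt]
    · show ((g * A t) ⊗ₖ (g * A t))ᵀ * Ω * ((g * A t) ⊗ₖ (g * A t)) ∈ _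
      obtain ⟨w1, w2, w3⟩ := hp.2
      dsimp only at w1 w2 w3
      set w := (g ⊗ₖ g)ᵀ * Ω * (g ⊗ₖ g) with hw
      have h2 : ((g * A t) ⊗ₖ (g * A t))ᵀ * Ω * ((g * A t) ⊗ₖ (g * A t)) =
          ((A t)ᵀ ⊗ₖ (A t)ᵀ) * w * (A t ⊗ₖ A t) := by
        rw [mul_kronecker_mul, transpose_mul, ← kroneckerMap_transpose _ (A t), hw]
        simp only [mul_assoc]
      rw [h2]
      -- An orthogonal matrix commuting with `Y` fixes `Y` under conjugation, so conjugating `w`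
      -- still yields a projection onto `h`.
      have hfix : ∀ Y ∈ h, (A t ⊗ₖ A t) *ᵥ vec Y = vec Y := fun Y hY => by
        rw [kronecker_mulVec_vec, hcomm t Y hY, mul_assoc, hAt', mul_one]
      have hfixT : ∀ Y ∈ h, ((A t)ᵀ ⊗ₖ (A t)ᵀ) *ᵥ vec Y = vec Y := fun Y hY => by
        rw [kronecker_mulVec_vec, hcommT t Y hY, mul_assoc, transpose_transpose, hAt, mul_one]
      refine ⟨fun Y hY => ?_, fun y => ?_, fun X hX => ?_⟩
      · rw [← mulVec_mulVec, ← mulVec_mulVec, hfix Y hY, w1 Y hY, hfixT Y hY]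
      · obtain ⟨Y, hY, hwY⟩ := w2 ((A t ⊗ₖ A t) *ᵥ y)
        exact ⟨Y, hY, by rw [← mulVec_mulVec, ← mulVec_mulVec, hwY, hfixT Y hY]⟩
      · have e1 := kronecker_self_mul_kroneckerDeriv (hcommT t X hX)
        have e2 := kronecker_self_mul_kroneckerDeriv (hcomm t X hX)
        rw [← mul_assoc, ← mul_assoc, ← e1, mul_assoc _ _ w, w3 X hX, mul_assoc, mul_assoc,
          ← e2]
        simp only [mul_assoc]
  have hd : HasDerivAt (fun t => ‖Ω‖ ^ 2 + ε * ‖g * A t‖ ^ 2)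
      (ε * (2 * (g * Z * gᴴ).trace.re)) 0 := by
    have h2 := ((hasDerivAt_frobenius_norm_sq (hA.const_mul g)).const_mul ε).const_add (‖Ω‖ ^ 2)
    refine h2.congr_deriv ?_
    rw [hA0, mul_one]
  have hloc : IsLocalMin (fun t => ‖Ω‖ ^ 2 + ε * ‖g * A t‖ ^ 2) 0 :=
    Eventually.of_forall fun t => by
      have := hmin _ (hmem t)
      simpa [hA0] using this
  have hzero := hloc.hasDerivAt_eq_zero hd
  linarith

end MinimalFrame

end PolarRep

namespace PolarRep

/-! ### Limits of minimal frames and normalization by conjugate transposes -/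

section MinimalFrame

open Matrix Filter Topology
open scoped Kronecker Matrix.Norms.Frobenius ComplexOrder

theorem projection_comm {E : Type*} [AddCommGroup E] [Module ℂ E] {p q : Submodule ℂ E}
    (hpq : IsCompl p q) (x y : E) {f : E →ₗ[ℂ] E} (hp : ∀ x ∈ p, f x ∈ p)
    (hq : ∀ x ∈ q, f x ∈ q) (hy : f x = y) :
    p.projection q hpq y = f (p.projection q hpq x) := by
  obtain ⟨a, ha, b, hb, rfl⟩ := Submodule.mem_sup.1 (show x ∈ p ⊔ q from hpq.sup_eq_top ▸ trivial)
  rw [← hy, map_add, map_add, map_add, Submodule.projection_apply_of_mem_left hpq (hp a ha),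
    Submodule.projection_apply_of_mem_right hpq (hq b hb),
    Submodule.projection_apply_of_mem_left hpq ha, Submodule.projection_apply_of_mem_right hpq hb]
  simp

theorem conjTranspose_transpose_eq_neg {ι : Type*} {X : Matrix ι ι ℂ} (hX : Xᵀ = -X) :
    Xᴴᵀ = -Xᴴ := by
  rw [← conjTranspose_transpose_eq_transpose_conjTranspose, hX, conjTranspose_neg]

theorem transpose_conj_eq_neg {ι : Type*} [Fintype ι] {g X : Matrix ι ι ℂ} (hX : Xᵀ = -X) :
    (g * X * gᵀ)ᵀ = -(g * X * gᵀ) := by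
  simp [transpose_mul, hX, mul_assoc]

variable {ι : Type*} [DecidableEq ι] [Fintype ι] {h : Submodule ℂ (Matrix ι ι ℂ)}

/-- The projection along an ad-stable complement is equivariant; this makes the minimization problem
nonempty. -/
theorem equivariantProjections_nonempty (hskew : ∀ X ∈ h, Xᵀ = -X)
    (hlie : ∀ X ∈ h, ∀ Y ∈ h, X * Y - Y * X ∈ h) {C : Submodule ℂ (Matrix ι ι ℂ)}
    (hC : IsCompl h C) (hCad : ∀ X ∈ h, ∀ Y ∈ C, X * Y - Y * X ∈ C) :
    (equivariantProjections h).Nonempty := by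
  let v : Matrix ι ι ℂ ≃ₗ[ℂ] (ι × ι → ℂ) := LinearEquiv.ofBijective
    { toFun := vec, map_add' := fun _ _ => rfl, map_smul' := fun _ _ => rfl } vec_bijective
  have hv : ∀ Y, v Y = vec Y := fun _ => rfl
  let w := LinearMap.toMatrix' (v.conj (h.projection C hC))
  have hw : ∀ Y, w *ᵥ vec Y = vec (h.projection C hC Y) := fun Y => by
    rw [← hv, LinearMap.toMatrix'_mulVec, LinearEquiv.conj_apply_apply, v.symm_apply_apply, hv]
  refine ⟨w, fun Y hY => ?_, fun y => ?_, fun X hX => ?_⟩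
  · rw [hw, Submodule.projection_apply_of_mem_left hC hY]
  · refine ⟨h.projection C hC (v.symm y), Submodule.projection_apply_mem hC _, ?_⟩
    rw [← hw, ← hv, v.apply_symm_apply]
  · refine toLin'.injective (LinearMap.ext fun y => ?_)
    obtain ⟨Y, rfl⟩ := v.surjective y
    rw [toLin'_apply, toLin'_apply, ← mulVec_mulVec, ← mulVec_mulVec, hv, hw,
      kroneckerDeriv_mulVec_vec (hskew X hX), kroneckerDeriv_mulVec_vec (hskew X hX), hw]
    congr 1
    exact (projection_comm hC Y _
      (f := LinearMap.mulLeft ℂ X - LinearMap.mulRight ℂ X) (hlie X hX) (hCad X hX) rfl).symm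

/-- The hypothesis on `A` says that its kernel is `h`-stable; `P` is the projection along `ker A`
onto an `h`-stable complement. -/
theorem exists_equivariant_projection
    (hss : ∀ K : Submodule ℂ (ι → ℂ), (∀ X ∈ h, ∀ x ∈ K, X *ᵥ x ∈ K) →
      ∃ C : Submodule ℂ (ι → ℂ), IsCompl K C ∧ ∀ X ∈ h, ∀ x ∈ C, X *ᵥ x ∈ C)
    {A : Matrix ι ι ℂ} (hA : ∀ X ∈ h, ∀ N : Matrix ι ι ℂ, A * N = 0 → A * (X * N) = 0) :
    ∃ P : Matrix ι ι ℂ, (∀ X ∈ h, P * X = X * P) ∧ A * P = A ∧ ∀ N, A * N = 0 → P * N = 0 := by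
  have hcol : ∀ x : ι → ℂ, A * (replicateCol ι x) = 0 ↔ A *ᵥ x = 0 := fun x => by
    rw [← replicateCol_mulVec]
    refine ⟨fun h => ?_, fun h => by rw [h]; rfl⟩
    ext i
    exact congrFun (congrFun h i) i
  have hK : ∀ X ∈ h, ∀ x ∈ LinearMap.ker A.mulVecLin, X *ᵥ x ∈ LinearMap.ker A.mulVecLin := by
    intro X hX x hx
    rw [LinearMap.mem_ker, mulVecLin_apply] at hx ⊢
    have := hA X hX _ ((hcol x).2 hx)
    rwa [← replicateCol_mulVec, hcol] at this
  obtain ⟨C, hC, hCs⟩ := hss _ hK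
  let P := LinearMap.toMatrix' (C.projection _ hC.symm)
  have hP : ∀ x, P *ᵥ x = C.projection _ hC.symm x := LinearMap.toMatrix'_mulVec _
  refine ⟨P, fun X hX => ?_, ?_, fun N hN => ?_⟩
  · refine toLin'.injective (LinearMap.ext fun y => ?_)
    rw [toLin'_apply, toLin'_apply, ← mulVec_mulVec, ← mulVec_mulVec, hP, hP]
    exact projection_comm hC.symm y _ (f := X.mulVecLin) (hCs X hX) (hK X hX) rfl
  · refine toLin'.injective (LinearMap.ext fun y => ?_)
    rw [toLin'_apply, toLin'_apply, ← mulVec_mulVec, hP]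
    have : C.projection _ hC.symm y - y ∈ LinearMap.ker A.mulVecLin := by
      rw [← Submodule.projection_apply_eq_zero_iff hC.symm, map_sub, sub_eq_zero]
      exact Submodule.projection_apply_of_mem_left _ (Submodule.projection_apply_mem _ _)
    rw [LinearMap.mem_ker, mulVecLin_apply, mulVec_sub] at this
    exact sub_eq_zero.1 this
  · refine ext_col fun j => ?_
    have h1 : A *ᵥ N.col j = 0 := funext fun i => congrFun (congrFun hN i) j
    have h2 : P *ᵥ N.col j = 0 := by
      rw [hP, Submodule.projection_apply_eq_zero_iff]
      exact h1
    exact h2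

theorem framePairs_commute {p : Matrix ι ι ℂ × Matrix (ι × ι) (ι × ι) ℂ} (hp : p ∈ framePairs h)
    {X : Matrix ι ι ℂ} (hX : X ∈ h) :
    kroneckerDeriv (p.1 * X * p.1ᵀ) * p.2 = p.2 * kroneckerDeriv (p.1 * X * p.1ᵀ) := by
  obtain ⟨g, Ω⟩ := p
  obtain ⟨hg, -, -, hw⟩ := hp
  dsimp only at hg hw ⊢
  have hg' : g * gᵀ = 1 := mul_eq_one_comm.1 hg
  have hr : (g ⊗ₖ g) * (g ⊗ₖ g)ᵀ = 1 := by
    rw [← kroneckerMap_transpose, ← mul_kronecker_mul, hg', one_kronecker_one]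
  have e1 := kronecker_self_mul_kroneckerDeriv (g := g) (X := X) (Y := g * X * gᵀ)
    (by rw [mul_assoc, hg, mul_one])
  have e2 := kronecker_self_mul_kroneckerDeriv (g := gᵀ) (Y := X) (X := g * X * gᵀ)
    (by rw [← mul_assoc, ← mul_assoc, hg, one_mul])
  rw [kroneckerMap_transpose] at e2
  set r := g ⊗ₖ g
  calc kroneckerDeriv (g * X * gᵀ) * Ω
      = kroneckerDeriv (g * X * gᵀ) * ((r * rᵀ) * Ω * (r * rᵀ)) := by rw [hr]; simp
    _ = (kroneckerDeriv (g * X * gᵀ) * r) * (rᵀ * Ω * r) * rᵀ := by simp only [mul_assoc]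
    _ = r * (kroneckerDeriv X * (rᵀ * Ω * r)) * rᵀ := by rw [← e1]; simp only [mul_assoc]
    _ = r * (rᵀ * Ω * r) * (kroneckerDeriv X * rᵀ) := by rw [hw X hX]; simp only [mul_assoc]
    _ = (r * rᵀ) * Ω * (r * rᵀ) * kroneckerDeriv (g * X * gᵀ) := by
        rw [← e2]; simp only [mul_assoc]
    _ = Ω * kroneckerDeriv (g * X * gᵀ) := by rw [hr]; simp

/-- `Ω` is a projection onto `g h gᵀ`, so an adjoint action commuting with `Ω` preserves that space.
-/
theorem normalizes_of_commute {p : Matrix ι ι ℂ × Matrix (ι × ι) (ι × ι) ℂ}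
    (hp : p ∈ framePairs h) {Z : Matrix ι ι ℂ} (hZ : Zᵀ = -Z)
    (hZΩ : kroneckerDeriv Z * p.2 = p.2 * kroneckerDeriv Z) {Y : Matrix ι ι ℂ} (hY : Y ∈ h) :
    ∃ W ∈ h, Z * (p.1 * Y * p.1ᵀ) - (p.1 * Y * p.1ᵀ) * Z = p.1 * W * p.1ᵀ := by
  obtain ⟨g, Ω⟩ := p
  obtain ⟨hg, hw1, hw2, -⟩ := hp
  dsimp only at hg hw1 hw2 hZΩ ⊢
  have hg' : g * gᵀ = 1 := mul_eq_one_comm.1 hg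
  have hr : (g ⊗ₖ g) * (g ⊗ₖ g)ᵀ = 1 := by
    rw [← kroneckerMap_transpose, ← mul_kronecker_mul, hg', one_kronecker_one]
  have hrv : ∀ Y, vec (g * Y * gᵀ) = (g ⊗ₖ g) *ᵥ vec Y := fun Y => (kronecker_mulVec_vec _ _ _).symm
  set r := g ⊗ₖ g
  have hΩ : Ω * r = r * (rᵀ * Ω * r) := by simp only [← mul_assoc, hr, one_mul]
  have hΩ' : Ω = r * (rᵀ * Ω * r) * rᵀ := by rw [← hΩ, mul_assoc, hr, mul_one]
  obtain ⟨W, hW, hWe⟩ := hw2 (rᵀ *ᵥ vec (Z * (g * Y * gᵀ) - (g * Y * gᵀ) * Z))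
  refine ⟨W, hW, vec_inj.1 ?_⟩
  have h1 : Ω *ᵥ vec (g * Y * gᵀ) = vec (g * Y * gᵀ) := by
    rw [hrv, mulVec_mulVec, hΩ, ← mulVec_mulVec, hw1 Y hY]
  rw [hrv, ← hWe, mulVec_mulVec, mulVec_mulVec, ← hΩ', ← kroneckerDeriv_mulVec_vec hZ,
    mulVec_mulVec, ← hZΩ, ← mulVec_mulVec, h1]

/-- Dropping the nonnegative commutator term from `minimal_framePair_left` leaves `‖gᴴ X'‖ ≤ ‖X' g‖`
for `X' = g X gᵀ`. The resulting bound is free of `ε` and homogeneous in `g`, hence survives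
rescaling and passage to the limit. -/
theorem norm_conjTranspose_mul_mul_le {ε : ℝ} (hε : 0 < ε) {g : Matrix ι ι ℂ}
    {Ω : Matrix (ι × ι) (ι × ι) ℂ} (hskew : ∀ X ∈ h, Xᵀ = -X) (hp : (g, Ω) ∈ framePairs h)
    (hmin : ∀ q ∈ framePairs h, ‖Ω‖ ^ 2 + ε * ‖g‖ ^ 2 ≤ ‖q.2‖ ^ 2 + ε * ‖q.1‖ ^ 2)
    {X : Matrix ι ι ℂ} (hX : X ∈ h) (N : Matrix ι ι ℂ) :
    ‖gᴴ * g * (X * N)‖ ≤ ‖g * X‖ * ‖g * N‖ := by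
  have hst := minimal_framePair_left hp hmin (transpose_conj_eq_neg (g := g) (hskew X hX))
    (framePairs_commute hp hX)
  have hg : gᵀ * g = 1 := hp.1
  set X' := g * X * gᵀ with hX'
  have hX'g : X' * g = g * X := by rw [hX', mul_assoc, hg, mul_one]
  clear_value X'
  have hneg : ((X' * X'ᴴ - X'ᴴ * X') * g * gᴴ).trace.re ≤ 0 := by
    by_contra hcon
    have := mul_pos hε (not_le.1 hcon)
    linarith [sq_nonneg ‖kroneckerDeriv X'ᴴ * Ω - Ω * kroneckerDeriv X'ᴴ‖]
  have e1 : ((X' * X'ᴴ - X'ᴴ * X') * g * gᴴ).trace.re = ‖gᴴ * X'‖ ^ 2 - ‖X' * g‖ ^ 2 := by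
    rw [frobenius_norm_sq, frobenius_norm_sq, ← Complex.sub_re]
    congr 1
    rw [sub_mul, sub_mul, trace_sub, conjTranspose_mul, conjTranspose_mul, conjTranspose_conjTranspose]
    congr 1
    · rw [mul_assoc (X' * X'ᴴ), trace_mul_comm, mul_assoc g, trace_mul_comm g]
      simp only [mul_assoc]
    · rw [mul_assoc (X'ᴴ * X'), mul_assoc X'ᴴ, trace_mul_comm X'ᴴ]
      simp only [mul_assoc]
  have h2 : ‖gᴴ * X'‖ ≤ ‖g * X‖ := by
    rw [← hX'g]
    exact abs_le_of_sq_le_sq' (by linarith) (norm_nonneg _) |>.2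
  have h3 : gᴴ * g * (X * N) = gᴴ * X' * (g * N) := by
    rw [mul_assoc, ← mul_assoc g X, ← hX'g]; simp only [mul_assoc]
  rw [h3]
  exact (norm_mul_le _ _).trans (mul_le_mul_of_nonneg_right h2 (norm_nonneg _))

/-- A completely reducible, ad-reductive Lie algebra of skew-symmetric matrices can be conjugated
by an orthogonal matrix so that it is normalised by its own conjugate transpose. -/
theorem exists_frame_conjTranspose_normalizes (hskew : ∀ X ∈ h, Xᵀ = -X)
    (hlie : ∀ X ∈ h, ∀ Y ∈ h, X * Y - Y * X ∈ h) {C : Submodule ℂ (Matrix ι ι ℂ)}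
    (hC : IsCompl h C) (hCad : ∀ X ∈ h, ∀ Y ∈ C, X * Y - Y * X ∈ C)
    (hss : ∀ K : Submodule ℂ (ι → ℂ), (∀ X ∈ h, ∀ x ∈ K, X *ᵥ x ∈ K) →
      ∃ C : Submodule ℂ (ι → ℂ), IsCompl K C ∧ ∀ X ∈ h, ∀ x ∈ C, X *ᵥ x ∈ C) :
    ∃ g : Matrix ι ι ℂ, gᵀ * g = 1 ∧ ∀ X ∈ h, ∀ Y ∈ h, ∃ W ∈ h,
      (g * X * gᵀ)ᴴ * (g * Y * gᵀ) - (g * Y * gᵀ) * (g * X * gᵀ)ᴴ = g * W * gᵀ := by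
  obtain ⟨w₀, hw₀⟩ := equivariantProjections_nonempty hskew hlie hC hCad
  have h₀ : ((1 : Matrix ι ι ℂ), w₀) ∈ framePairs h := by
    refine ⟨by simp, ?_⟩
    simpa using hw₀
  have hε : ∀ n : ℕ, (0 : ℝ) < 1 / ((n : ℝ) + 1) := fun n => by positivity
  have hεlim : Tendsto (fun n : ℕ => (1 : ℝ) / ((n : ℝ) + 1)) atTop (𝓝 0) :=
    tendsto_one_div_add_atTop_nhds_zero_nat
  choose p hp hmin using fun n => exists_minimal_framePair h (hε n) ⟨_, h₀⟩
  -- Either the frames have a bounded subsequence as `ε → 0`, and its limit works, or their norms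
  -- tend to infinity, which is contradictory.
  by_cases hb : ∃ R : ℝ, ∃ᶠ n in atTop, ‖(p n).1‖ ≤ R
  · obtain ⟨R, hR⟩ := hb
    have hΩ : ∀ n, ‖(p n).2‖ ≤ Real.sqrt (‖w₀‖ ^ 2 + ‖(1 : Matrix ι ι ℂ)‖ ^ 2) := fun n => by
      refine Real.le_sqrt_of_sq_le ?_
      have h1 := hmin n _ h₀
      have h2 : 0 ≤ 1 / ((n : ℝ) + 1) * ‖(p n).1‖ ^ 2 := mul_nonneg (hε n).le (sq_nonneg _)
      have h3 : 1 / ((n : ℝ) + 1) * ‖(1 : Matrix ι ι ℂ)‖ ^ 2 ≤ 1 * ‖(1 : Matrix ι ι ℂ)‖ ^ 2 := by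
        refine mul_le_mul_of_nonneg_right ?_ (sq_nonneg _)
        rw [div_le_one (by positivity)]
        linarith [(Nat.cast_nonneg n : (0 : ℝ) ≤ n)]
      dsimp only at h1
      linarith
    have : ProperSpace (Matrix ι ι ℂ × Matrix (ι × ι) (ι × ι) ℂ) := FiniteDimensional.proper ℂ _
    obtain ⟨a, -, φ, hφ, hlim⟩ := tendsto_subseq_of_frequently_bounded
      (Metric.isBounded_closedBall (x := (0 : Matrix ι ι ℂ × Matrix (ι × ι) (ι × ι) ℂ))
        (r := max R (Real.sqrt (‖w₀‖ ^ 2 + ‖(1 : Matrix ι ι ℂ)‖ ^ 2)))) (x := p)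
      (hR.mono fun n hn => by
        rw [mem_closedBall_zero_iff]
        exact max_le_max hn (hΩ n))
    have ha : a ∈ framePairs h :=
      (isClosed_framePairs h).mem_of_tendsto hlim (Eventually.of_forall fun n => hp _)
    refine ⟨a.1, ha.1, fun X hX Y hY => ?_⟩
    refine normalizes_of_commute ha
      (conjTranspose_transpose_eq_neg (transpose_conj_eq_neg (hskew X hX))) ?_ hY
    let D : Matrix ι ι ℂ × Matrix (ι × ι) (ι × ι) ℂ → Matrix (ι × ι) (ι × ι) ℂ := fun q =>
      kroneckerDeriv (q.1 * X * q.1ᵀ)ᴴ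
    have hX1 : Continuous fun q : Matrix ι ι ℂ × Matrix (ι × ι) (ι × ι) ℂ => q.1 * X * q.1ᵀ :=
      (continuous_fst.mul continuous_const).mul continuous_fst.matrix_transpose
    have hD : Continuous D := by
      have h1 := hX1.matrix_conjTranspose
      refine continuous_matrix fun i j => ?_
      exact ((h1.matrix_elem _ _).mul continuous_const).add
        (continuous_const.mul (h1.matrix_elem _ _))
    have hψ : Continuous fun q : Matrix ι ι ℂ × Matrix (ι × ι) (ι × ι) ℂ =>
        ‖D q * q.2 - q.2 * D q‖ ^ 2 :=
      (((hD.mul continuous_snd).sub (continuous_snd.mul hD)).norm).pow 2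
    have hχ : Continuous fun q : Matrix ι ι ℂ × Matrix (ι × ι) (ι × ι) ℂ =>
        (((q.1 * X * q.1ᵀ) * (q.1 * X * q.1ᵀ)ᴴ - (q.1 * X * q.1ᵀ)ᴴ * (q.1 * X * q.1ᵀ)) *
          q.1 * q.1ᴴ).trace.re := by
      have h1 := hX1.matrix_conjTranspose
      exact Complex.continuous_re.comp (Continuous.matrix_trace
        ((((hX1.mul h1).sub (h1.mul hX1)).mul continuous_fst).mul
          continuous_fst.matrix_conjTranspose))
    have hlim2 := ((hψ.tendsto a).comp hlim).add
      ((hεlim.comp hφ.tendsto_atTop).mul ((hχ.tendsto a).comp hlim))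
    -- The stationarity equation passes to the limit; its second term disappears with `ε`.
    have hz : ‖D a * a.2 - a.2 * D a‖ ^ 2 = 0 := by
      refine tendsto_nhds_unique ((hlim2.congr fun n => ?_).trans (by rw [zero_mul, add_zero]))
        tendsto_const_nhds
      exact minimal_framePair_left (hp (φ n)) (hmin (φ n))
        (transpose_conj_eq_neg (hskew X hX)) (framePairs_commute (hp (φ n)) hX)
    exact sub_eq_zero.1 (norm_eq_zero.1 (pow_eq_zero_iff two_ne_zero |>.1 hz))
  · exfalso
    push Not at hb
    let c : ℕ → ℂ := fun n => ((‖(p n).1‖⁻¹ : ℝ) : ℂ)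
    let γ : ℕ → Matrix ι ι ℂ := fun n => c n • (p n).1
    have hcn : ∀ n, ‖c n‖ = ‖(p n).1‖⁻¹ := fun n => by
      simp [c]
    have hγ1 : ∀ᶠ n in atTop, ‖γ n‖ = 1 := (hb 0).mono fun n hn => by
      rw [norm_smul, hcn, inv_mul_cancel₀ hn.ne']
    have hnorm : Tendsto (fun n => ‖(p n).1‖) atTop atTop :=
      tendsto_atTop.2 fun R => (hb R).mono fun n hn => hn.le
    have hc0 : Tendsto c atTop (𝓝 0) := by
      rw [tendsto_zero_iff_norm_tendsto_zero]
      simp only [hcn]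
      exact hnorm.inv_tendsto_atTop
    have : ProperSpace (Matrix ι ι ℂ) := FiniteDimensional.proper ℂ _
    obtain ⟨a, -, φ, hφ, hlim⟩ := tendsto_subseq_of_frequently_bounded
      (Metric.isBounded_closedBall (x := (0 : Matrix ι ι ℂ)) (r := 1)) (x := γ)
      (hγ1.frequently.mono fun n hn => by
        rw [mem_closedBall_zero_iff]
        exact hn.le)
    have hφt := hφ.tendsto_atTop
    have ha1 : ‖a‖ = 1 := by
      refine tendsto_nhds_unique ((continuous_norm.tendsto a).comp hlim)
        (tendsto_const_nhds.congr' ?_)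
      exact (hφt.eventually hγ1).mono fun n hn => hn.symm
    -- Orthogonality of `g` rescales to `γ γᵀ = ‖g‖⁻² · 1`, which tends to zero.
    have haT : a * aᵀ = 0 := by
      have h1 : Tendsto (fun n => γ (φ n) * (γ (φ n))ᵀ) atTop (𝓝 (a * aᵀ)) :=
        ((continuous_id.mul continuous_id.matrix_transpose).tendsto a).comp hlim
      have h2 : Tendsto (fun n => (c (φ n) * c (φ n)) • (1 : Matrix ι ι ℂ)) atTop
          (𝓝 (((0 : ℂ) * 0) • (1 : Matrix ι ι ℂ))) :=
        ((hc0.comp hφt).mul (hc0.comp hφt)).smul_const _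
      have h3 : (fun n => γ (φ n) * (γ (φ n))ᵀ) =
          fun n => (c (φ n) * c (φ n)) • (1 : Matrix ι ι ℂ) := by
        funext n
        have : (p (φ n)).1 * (p (φ n)).1ᵀ = 1 := mul_eq_one_comm.1 (hp (φ n)).1
        simp only [γ, transpose_smul, smul_mul_smul_comm, this]
      rw [h3] at h1
      simpa using tendsto_nhds_unique h1 h2
    -- In the limit the norm bound shows that `ker a` is stable under `h`.
    have hker : ∀ X ∈ h, ∀ N : Matrix ι ι ℂ, a * N = 0 → a * (X * N) = 0 := by
      intro X hX N hN
      have hle : ∀ n, ‖(γ n)ᴴ * γ n * (X * N)‖ ≤ ‖γ n * X‖ * ‖γ n * N‖ := by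
        intro n
        have h1 := norm_conjTranspose_mul_mul_le (hε n) hskew (hp n) (hmin n) hX N
        simp only [γ, conjTranspose_smul, smul_mul_assoc, mul_smul_comm, norm_smul, norm_star]
        calc _ ≤ ‖c n‖ * (‖c n‖ * (‖(p n).1 * X‖ * ‖(p n).1 * N‖)) := by gcongr
          _ = _ := by ring
      have h1 := ((((continuous_id.matrix_conjTranspose.mul continuous_id).mul
        (continuous_const (y := X * N))).norm).tendsto a).comp hlim
      have h2 := ((((continuous_id.mul (continuous_const (y := X))).norm).mul
        ((continuous_id.mul (continuous_const (y := N))).norm)).tendsto a).comp hlim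
      have h3 := le_of_tendsto_of_tendsto' h1 h2 fun n => hle (φ n)
      replace h3 : ‖aᴴ * a * (X * N)‖ ≤ ‖a * X‖ * ‖a * N‖ := h3
      rw [hN, norm_zero, mul_zero] at h3
      exact (conjTranspose_mul_self_mul_eq_zero _ _).1 (norm_le_zero_iff.1 h3)
    obtain ⟨P, hPX, haP, hPker⟩ := exists_equivariant_projection hss hker
    have haPT : a * Pᵀ = 0 := by
      rw [← transpose_transpose (a * Pᵀ), transpose_mul, transpose_transpose, hPker _ haT,
        transpose_zero]
    have hPTX : ∀ X ∈ h, Pᵀ * X = X * Pᵀ := fun X hX => by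
      have := congrArg transpose (hPX X hX)
      rw [transpose_mul, transpose_mul, hskew X hX] at this
      simpa using this.symm
    -- `P - Pᵀ` is skew and centralizes `h`, hence is an admissible direction for the right
    -- variation. Since `a P = a` and `a Pᵀ = 0`, the limit of the vanishing traces is `‖a‖² = 1`, a
    -- contradiction.
    have hZ : (P - Pᵀ)ᵀ = -(P - Pᵀ) := by simp
    have hZX : ∀ X ∈ h, (P - Pᵀ) * X = X * (P - Pᵀ) := fun X hX => by
      rw [sub_mul, mul_sub, hPX X hX, hPTX X hX]
    have h1 : ∀ n, (γ n * (P - Pᵀ) * (γ n)ᴴ).trace.re = 0 := by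
      intro n
      have h2 := minimal_framePair_right (hp n) (hmin n) hZ hZX
      have h3 := (mul_eq_zero.1 h2).resolve_left (hε n).ne'
      have h4 : c n * star (c n) = ((‖(p n).1‖⁻¹ * ‖(p n).1‖⁻¹ : ℝ) : ℂ) := by
        simp [c]
      simp only [γ, conjTranspose_smul, smul_mul_assoc, mul_smul_comm, trace_smul, smul_smul,
        mul_comm (star (c n)), h4, smul_eq_mul, Complex.re_ofReal_mul, h3, mul_zero]
    have h2 := ((Complex.continuous_re.comp (Continuous.matrix_trace
      ((continuous_id.mul (continuous_const (y := P - Pᵀ))).mul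
        continuous_id.matrix_conjTranspose))).tendsto a).comp hlim
    have h3 : (a * (P - Pᵀ) * aᴴ).trace.re = 0 := by
      refine tendsto_nhds_unique h2 (tendsto_const_nhds.congr fun n => (h1 (φ n)).symm)
    rw [mul_sub, haP, haPT, sub_zero, ← frobenius_norm_sq, ha1] at h3
    norm_num at h3

end MinimalFrame

end PolarRep

namespace PolarRep

/-! ### Nondegeneracy of the form on the tangent space at a real point -/

section RealPoints

open Matrix
open scoped ComplexOrder

variable {ι : Type*} [Fintype ι]

theorem mulVec_dotProduct_of_skew {X : Matrix ι ι ℂ} (hX : Xᵀ = -X) (u w : ι → ℂ) :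
    (X *ᵥ u) ⬝ᵥ w = -(u ⬝ᵥ (X *ᵥ w)) := by
  rw [dotProduct_mulVec, ← mulVec_transpose, hX, neg_mulVec, neg_dotProduct, neg_neg]

theorem mem_of_forall_dotProduct_eq_zero {O : Submodule ℂ (ι → ℂ)} {w : ι → ℂ}
    (hw : ∀ u : ι → ℂ, (∀ y ∈ O, u ⬝ᵥ y = 0) → u ⬝ᵥ w = 0) : w ∈ O := by
  classical
  by_contra h
  obtain ⟨l, hl, hO⟩ := Submodule.exists_le_ker_of_notMem h
  have hlu : ∀ y, l y = (fun i => l (Pi.single i 1)) ⬝ᵥ y := fun y => by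
    conv_lhs => rw [pi_eq_sum_univ' y, map_sum]
    simp only [map_smul, smul_eq_mul, dotProduct]
    refine Finset.sum_congr rfl fun i _ => ?_
    rw [mul_comm]
  refine hl ?_
  rw [hlu]
  exact hw _ fun y hy => by rw [← hlu]; exact hO hy

/-- A normal operator `A` with `A Aᴴ` and `A²` preserving `O` maps a vector `v` with `A v ∈ O` into
`O` under its adjoint. -/
theorem conjTranspose_mulVec_mem_of_normal {A : Matrix ι ι ℂ} (hA : A * Aᴴ = Aᴴ * A)
    {O : Submodule ℂ (ι → ℂ)} {v : ι → ℂ} (hv : A *ᵥ v ∈ O) (h1 : ∀ y ∈ O, (A * A) *ᵥ y ∈ O)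
    (h2 : ∀ y ∈ O, (A * Aᴴ) *ᵥ y ∈ O) : Aᴴ *ᵥ v ∈ O := by
  have hker : ∀ x, A *ᵥ x = 0 → Aᴴ *ᵥ x = 0 := fun x hx => by
    rw [← self_mul_conjTranspose_mulVec_eq_zero, hA, ← mulVec_mulVec, hx, mulVec_zero]
  have hsq : ∀ x, A *ᵥ (A *ᵥ x) = 0 → A *ᵥ x = 0 := fun x hx => by
    rw [← conjTranspose_mul_self_mulVec_eq_zero, ← mulVec_mulVec, hker _ hx]
  -- For normal `A` the range meets the kernel trivially, so `A²` is injective on `S`, hence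
  -- bijective.
  let S : Submodule ℂ (ι → ℂ) := O ⊓ LinearMap.range A.mulVecLin
  have hS : ∀ s ∈ S, (A * A).mulVecLin s ∈ S := fun s hs =>
    ⟨h1 s hs.1, A *ᵥ s, by simp⟩
  let f : S →ₗ[ℂ] S := (A * A).mulVecLin.restrict hS
  have hf : ∀ s : S, (f s : ι → ℂ) = A *ᵥ (A *ᵥ s) := fun s => by
    rw [mulVec_mulVec]; rfl
  have hinj : Function.Injective f := by
    refine (injective_iff_map_eq_zero f).2 fun s hs => ?_
    obtain ⟨s, hsO, x, rfl⟩ := s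
    have h3 : A *ᵥ (A *ᵥ (A *ᵥ x)) = 0 := by
      have := congrArg Subtype.val hs
      rwa [hf] at this
    exact Subtype.ext (hsq _ (hsq _ h3))
  -- By normality `A² Aᴴ v = (A Aᴴ)(A v)`. The preimage `s ∈ S` under `A²` then differs from `Aᴴ v`
  -- by a kernel vector that is also Hermitian-orthogonal to the kernel.
  have ht : A *ᵥ (A *ᵥ (Aᴴ *ᵥ v)) ∈ S := by
    refine ⟨?_, ⟨_, rfl⟩⟩
    have := h2 _ hv
    rwa [← mulVec_mulVec, mulVec_mulVec v, ← hA, ← mulVec_mulVec] at this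
  obtain ⟨⟨s, hsO, x, hx⟩, hs⟩ := (LinearMap.injective_iff_surjective.1 hinj) ⟨_, ht⟩
  have hs' : A *ᵥ (A *ᵥ s) = A *ᵥ (A *ᵥ (Aᴴ *ᵥ v)) := by
    have := congrArg Subtype.val hs
    rwa [hf] at this
  have he : A *ᵥ (s - Aᴴ *ᵥ v) = 0 := hsq _ (by rw [mulVec_sub, mulVec_sub, hs', sub_self])
  have he0 : s - Aᴴ *ᵥ v = 0 := by
    have h4 : ∀ e : ι → ℂ, A *ᵥ e = 0 → star e ⬝ᵥ (s - Aᴴ *ᵥ v) = 0 := fun e he => by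
      have h5 := star_mulVec Aᴴ e
      rw [hker e he, conjTranspose_conjTranspose, star_zero] at h5
      have h6 := star_mulVec A e
      rw [he, star_zero] at h6
      rw [dotProduct_sub, ← hx, mulVecLin_apply, dotProduct_mulVec, dotProduct_mulVec, ← h5, ← h6]
      simp
    exact dotProduct_star_self_eq_zero.1 (h4 _ he)
  rw [← sub_eq_zero.1 he0]
  exact hsO

theorem trace_commutator_mul (A Y Z : Matrix ι ι ℂ) :
    ((A * Y - Y * A) * Z).trace = (A * (Y * Z - Z * Y)).trace := by
  rw [sub_mul, mul_sub, trace_sub, trace_sub, mul_assoc, mul_assoc Y, trace_mul_comm Y, mul_assoc]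

/-- Let `h` be a space of skew-symmetric matrices normalised by its conjugate transpose, and `v` a
real vector such that the orthogonal complement of `h v` is orthogonal to its `h`-translates. Then
the dot product is nondegenerate on `h v`. -/
theorem eq_zero_of_orthogonal_of_real {h : Submodule ℂ (Matrix ι ι ℂ)} (hskew : ∀ X ∈ h, Xᵀ = -X)
    (hnorm : ∀ X ∈ h, ∀ Y ∈ h, Xᴴ * Y - Y * Xᴴ ∈ h) {v : ι → ℂ} (hv : star v = v)
    (hcomm : ∀ u₁ u₂ : ι → ℂ, (∀ X ∈ h, u₁ ⬝ᵥ (X *ᵥ v) = 0) → (∀ X ∈ h, u₂ ⬝ᵥ (X *ᵥ v) = 0) →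
      ∀ X ∈ h, u₁ ⬝ᵥ (X *ᵥ u₂) = 0)
    {X : Matrix ι ι ℂ} (hX : X ∈ h) (hXv : ∀ Y ∈ h, (X *ᵥ v) ⬝ᵥ (Y *ᵥ v) = 0) : X *ᵥ v = 0 := by
  let ev : Matrix ι ι ℂ →ₗ[ℂ] (ι → ℂ) :=
    { toFun := fun X => X *ᵥ v
      map_add' := fun X Y => add_mulVec X Y v
      map_smul' := fun c X => smul_mulVec c X v }
  let O : Submodule ℂ (ι → ℂ) := h.map ev
  have hO : ∀ X ∈ h, X *ᵥ v ∈ O := fun X hX => Submodule.mem_map_of_mem (f := ev) hX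
  have hOmem : ∀ y ∈ O, ∃ X ∈ h, X *ᵥ v = y := fun y hy => Submodule.mem_map.1 hy
  -- For `d` symmetric and centralizing `h`, skewness makes `d v` orthogonal to `O`; the hypothesis
  -- on orthogonal vectors then puts `X d v = d X v` in the double orthogonal of `O`.
  have hD : ∀ d : Matrix ι ι ℂ, dᵀ = d → (∀ X ∈ h, d * X = X * d) → ∀ y ∈ O, d *ᵥ y ∈ O := by
    intro d hd hdX y hy
    obtain ⟨X, hX, rfl⟩ := hOmem y hy
    refine mem_of_forall_dotProduct_eq_zero fun u hu => ?_
    rw [mulVec_mulVec, hdX X hX, ← mulVec_mulVec]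
    refine hcomm u (d *ᵥ v) (fun Y hY => hu _ (hO Y hY)) (fun Y hY => ?_) X hX
    have h1 : (d *ᵥ v) ⬝ᵥ (Y *ᵥ v) = v ⬝ᵥ (Y *ᵥ (d *ᵥ v)) := by
      rw [mulVec_mulVec, ← hdX Y hY, ← mulVec_mulVec, dotProduct_mulVec v d, ← mulVec_transpose, hd]
    have h2 := mulVec_dotProduct_of_skew (hskew Y hY) v (d *ᵥ v)
    rw [dotProduct_comm, h1] at h2
    rw [h1]
    linear_combination (1 / 2 : ℂ) * h2
  -- The self-adjoint part of `h`. It contains every `[X, Zᴴ]` with `X, Z ∈ h`, and the trace form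
  -- is nondegenerate on it. Hence each element of `h` splits as an element of `h₁` plus one
  -- trace-orthogonal to `h₁`.
  let h₁ : Submodule ℂ (Matrix ι ι ℂ) :=
    { carrier := {X | X ∈ h ∧ Xᴴ ∈ h}
      add_mem' := fun {X Y} hX hY =>
        ⟨h.add_mem hX.1 hY.1, by rw [conjTranspose_add]; exact h.add_mem hX.2 hY.2⟩
      zero_mem' := ⟨h.zero_mem, by rw [conjTranspose_zero]; exact h.zero_mem⟩
      smul_mem' := fun c X hX =>
        ⟨h.smul_mem c hX.1, by rw [conjTranspose_smul]; exact h.smul_mem _ hX.2⟩ }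
  have hneg : ∀ X Y : Matrix ι ι ℂ, X * Y - Y * X ∈ h → Y * X - X * Y ∈ h := fun X Y hXY => by
    rw [← neg_sub]; exact h.neg_mem hXY
  have hstar : ∀ Y ∈ h₁, Yᴴ ∈ h₁ := fun Y hY => ⟨hY.2, by rw [conjTranspose_conjTranspose]; exact hY.1⟩
  have hb : ∀ X ∈ h, ∀ Z ∈ h, X * Zᴴ - Zᴴ * X ∈ h₁ := fun X hX Z hZ => by
    refine ⟨hneg _ _ (hnorm Z hZ X hX), ?_⟩
    simp only [conjTranspose_sub, conjTranspose_mul, conjTranspose_conjTranspose]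
    exact hneg _ _ (hnorm X hX Z hZ)
  have hb1 : ∀ X ∈ h, ∀ Y ∈ h₁, X * Y - Y * X ∈ h₁ := fun X hX Y hY => by
    simpa using hb X hX Yᴴ hY.2
  have hnd : ∀ Z ∈ h₁, (∀ W ∈ h₁, (Z * W).trace = 0) → Z = 0 := fun Z hZ hW =>
    trace_mul_conjTranspose_self_eq_zero_iff.1 (hW _ (hstar Z hZ))
  have hdec : ∀ X ∈ h, ∃ Y ∈ h₁, X - Y ∈ h ∧ ∀ W ∈ h₁, ((X - Y) * W).trace = 0 := by
    intro X hX
    let τ : Matrix ι ι ℂ →ₗ[ℂ] Module.Dual ℂ (Matrix ι ι ℂ) :=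
      LinearMap.mk₂ ℂ (fun X Y => (X * Y).trace)
        (fun _ _ _ => by rw [add_mul, trace_add]) (fun _ _ _ => by rw [smul_mul_assoc, trace_smul])
        (fun _ _ _ => by rw [mul_add, trace_add]) (fun _ _ _ => by rw [mul_smul_comm, trace_smul])
    let τ₁ : h₁ →ₗ[ℂ] Module.Dual ℂ h₁ := (h₁.subtype.dualMap ∘ₗ τ) ∘ₗ h₁.subtype
    have hinj : Function.Injective τ₁ := by
      refine (injective_iff_map_eq_zero τ₁).2 fun Z hZ => Subtype.ext (hnd Z Z.2 fun W hW => ?_)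
      exact LinearMap.congr_fun hZ ⟨W, hW⟩
    have hsurj := (LinearMap.injective_iff_surjective_of_finrank_eq_finrank
      (Subspace.dual_finrank_eq (K := ℂ) (V := h₁)).symm).1 hinj
    obtain ⟨Y, hY⟩ := hsurj (h₁.subtype.dualMap (τ X))
    refine ⟨Y, Y.2, h.sub_mem hX Y.2.1, fun W hW => ?_⟩
    have : ((Y : Matrix ι ι ℂ) * W).trace = (X * W).trace := LinearMap.congr_fun hY ⟨W, hW⟩
    rw [sub_mul, trace_sub, this, sub_self]
  have horth : ∀ Z ∈ h, (∀ W ∈ h₁, (Z * W).trace = 0) → (∀ W ∈ h₁, Z * W = W * Z) := by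
    intro Z hZ hZt W hW
    refine sub_eq_zero.1 (hnd _ (hb1 Z hZ W hW) fun V hV => ?_)
    rw [trace_commutator_mul, hZt _ (hb1 W hW.1 V hV)]
  have hnormal : ∀ A ∈ h, (∀ W ∈ h₁, (A * W).trace = 0) →
      ∀ Z ∈ h, (∀ W ∈ h₁, (Z * W).trace = 0) → A * Zᴴ = Zᴴ * A := by
    intro A hA hAt Z hZ hZt
    refine sub_eq_zero.1 (hnd _ (hb A hA Z hZ) fun W hW => ?_)
    have h1 := congrArg conjTranspose (horth Z hZ hZt _ (hstar W hW))
    simp only [conjTranspose_mul, conjTranspose_conjTranspose] at h1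
    rw [trace_commutator_mul, h1, sub_self, mul_zero, trace_zero]
  have habel : ∀ A ∈ h, (∀ W ∈ h₁, (A * W).trace = 0) →
      ∀ Z ∈ h, (∀ W ∈ h₁, (Z * W).trace = 0) → A * Z = Z * A := by
    intro A hA hAt Z hZ hZt
    refine sub_eq_zero.1 (trace_mul_conjTranspose_self_eq_zero_iff.1 ?_)
    have h1 := hnormal Z hZ hZt Z hZ hZt
    have h2 := hnormal Z hZ hZt A hA hAt
    rw [trace_commutator_mul]
    simp only [conjTranspose_sub, conjTranspose_mul, mul_sub, sub_mul]
    rw [← mul_assoc Z Zᴴ, h1, mul_assoc Zᴴ Z, h2, ← mul_assoc Z Aᴴ, h2, mul_assoc Aᴴ Z, h1]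
    simp only [mul_assoc, sub_self, trace_zero]
  have hconj : ∀ X ∈ h, Xᴴ *ᵥ v ∈ O := by
    intro X hX
    obtain ⟨Y, hY, hA, hAt⟩ := hdec X hX
    obtain ⟨A, hAdef⟩ : ∃ A, A = X - Y := ⟨_, rfl⟩
    rw [← hAdef] at hA hAt
    have hAA : A * Aᴴ = Aᴴ * A := hnormal A hA hAt A hA hAt
    -- The trace-orthogonal component `A` is normal, and `A` and `Aᴴ` centralize `h`. Thus `A²` and
    -- `A Aᴴ` are symmetric and centralize `h`, as `hD` requires.
    have hAX : ∀ Z ∈ h, A * Z = Z * A ∧ Aᴴ * Z = Z * Aᴴ := by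
      intro Z hZ
      obtain ⟨W, hW, hC, hCt⟩ := hdec Z hZ
      obtain ⟨C, hCdef⟩ : ∃ C, C = Z - W := ⟨_, rfl⟩
      rw [← hCdef] at hC hCt
      have hZe : Z = W + C := by rw [hCdef]; abel
      have h1 := horth A hA hAt W hW
      have h2 := congrArg conjTranspose (horth A hA hAt _ (hstar W hW))
      simp only [conjTranspose_mul, conjTranspose_conjTranspose] at h2
      rw [hZe]
      refine ⟨?_, ?_⟩
      · rw [mul_add, add_mul, h1, habel A hA hAt C hC hCt]
      · rw [mul_add, add_mul, h2, hnormal C hC hCt A hA hAt]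
    have hAv : Aᴴ *ᵥ v ∈ O := by
      refine conjTranspose_mulVec_mem_of_normal hAA (hO A hA) (hD _ ?_ ?_) (hD _ ?_ ?_)
      · rw [transpose_mul, hskew A hA, neg_mul_neg]
      · intro Z hZ
        rw [mul_assoc, (hAX Z hZ).1, ← mul_assoc, (hAX Z hZ).1, mul_assoc]
      · rw [transpose_mul, hskew A hA, conjTranspose_transpose_eq_neg (hskew A hA), neg_mul_neg, hAA]
      · intro Z hZ
        rw [mul_assoc, (hAX Z hZ).2, ← mul_assoc, (hAX Z hZ).1, mul_assoc]
    have hXe : Xᴴ = Aᴴ + Yᴴ := by rw [← conjTranspose_add, hAdef, sub_add_cancel]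
    rw [hXe, add_mulVec]
    exact O.add_mem hAv (hO _ hY.2)
  obtain ⟨W, hW, hWv⟩ := hOmem _ (hconj X hX)
  -- Reality of `v` and skewness of `X` identify the complex conjugate of `X v` with `-Xᴴ v`, which
  -- lies in `h v`; so `X v` is Hermitian-orthogonal to itself.
  have h1 : star (X *ᵥ v) = -(W *ᵥ v) := by
    rw [star_mulVec, hv, ← mulVec_transpose, conjTranspose_transpose_eq_neg (hskew X hX), neg_mulVec,
      hWv]
  refine dotProduct_star_self_eq_zero.1 ?_
  rw [h1, neg_dotProduct, dotProduct_comm, hXv W hW, neg_zero]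

end RealPoints

end PolarRep

namespace PolarRep

open Module

/-! ### Polynomial functions and general points -/

section PolynomialFunctions

variable {V : Type*} [AddCommGroup V] [Module ℂ V]

/-- The algebra of polynomial functions on a vector space. -/
def polyFun (V : Type*) [AddCommGroup V] [Module ℂ V] : Subalgebra ℂ (V → ℂ) :=
  Algebra.adjoin ℂ (Set.range fun (l : Dual ℂ V) (v : V) => l v)

theorem dual_mem_polyFun (l : Dual ℂ V) : (fun v => l v) ∈ polyFun V :=
  Algebra.subset_adjoin ⟨l, rfl⟩

theorem const_mem_polyFun (c : ℂ) : (fun _ : V => c) ∈ polyFun V :=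
  (polyFun V).algebraMap_mem c

theorem sum_mem_polyFun {α : Type*} (s : Finset α) {f : α → V → ℂ} (hf : ∀ i, f i ∈ polyFun V) :
    (fun v => ∑ i ∈ s, f i v) ∈ polyFun V := by
  have := (polyFun V).sum_mem (t := s) fun i _ => hf i
  convert this using 1
  ext v
  simp

theorem mul_mem_polyFun {f g : V → ℂ} (hf : f ∈ polyFun V) (hg : g ∈ polyFun V) :
    (fun v => f v * g v) ∈ polyFun V := (polyFun V).mul_mem hf hg

theorem sub_mem_polyFun {f g : V → ℂ} (hf : f ∈ polyFun V) (hg : g ∈ polyFun V) :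
    (fun v => f v - g v) ∈ polyFun V := (polyFun V).sub_mem hf hg

theorem det_mem_polyFun {α : Type*} [Fintype α] [DecidableEq α] {M : V → Matrix α α ℂ}
    (hM : ∀ i j, (fun v => M v i j) ∈ polyFun V) : (fun v => (M v).det) ∈ polyFun V := by
  simp only [Matrix.det_apply']
  refine sum_mem_polyFun _ fun σ => mul_mem_polyFun (const_mem_polyFun _) ?_
  have := (polyFun V).prod_mem (t := Finset.univ) fun i _ => hM (σ i) i
  convert this using 1
  ext v
  simp

theorem adjugate_mem_polyFun {α : Type*} [Fintype α] [DecidableEq α] {M : V → Matrix α α ℂ}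
    (hM : ∀ i j, (fun v => M v i j) ∈ polyFun V) (i j : α) :
    (fun v => (M v).adjugate i j) ∈ polyFun V := by
  simp only [Matrix.adjugate_apply]
  refine det_mem_polyFun fun k l => ?_
  by_cases h : k = j
  · subst h
    simp only [Matrix.updateRow_self]
    exact const_mem_polyFun _
  · simp only [Matrix.updateRow_ne h]
    exact hM k l

/-- The maps from a vector space to a vector space with polynomial components. -/
def IsPolyMap {W : Type*} [AddCommGroup W] [Module ℂ W] (F : V → W) : Prop :=
  ∀ l : Dual ℂ W, (fun v => l (F v)) ∈ polyFun V

section IsPolyMap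

variable {W : Type*} [AddCommGroup W] [Module ℂ W] {F F' : V → W}

theorem IsPolyMap.const (w : W) : IsPolyMap fun _ : V => w := fun l => const_mem_polyFun (l w)

theorem IsPolyMap.of_linear (T : V →ₗ[ℂ] W) : IsPolyMap T := fun l => dual_mem_polyFun (l ∘ₗ T)

theorem IsPolyMap.linear_comp {W' : Type*} [AddCommGroup W'] [Module ℂ W'] (hF : IsPolyMap F)
    (T : W →ₗ[ℂ] W') : IsPolyMap fun v => T (F v) := fun l => hF (l ∘ₗ T)

theorem IsPolyMap.sub (hF : IsPolyMap F) (hF' : IsPolyMap F') : IsPolyMap fun v => F v - F' v :=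
  fun l => by simpa only [map_sub] using sub_mem_polyFun (hF l) (hF' l)

theorem IsPolyMap.smul {f : V → ℂ} (hf : f ∈ polyFun V) (hF : IsPolyMap F) :
    IsPolyMap fun v => f v • F v :=
  fun l => by simpa only [map_smul, smul_eq_mul] using mul_mem_polyFun hf (hF l)

theorem IsPolyMap.sum {α : Type*} (s : Finset α) {F : α → V → W} (hF : ∀ i, IsPolyMap (F i)) :
    IsPolyMap fun v => ∑ i ∈ s, F i v :=
  fun l => by simpa only [map_sum] using sum_mem_polyFun s fun i => hF i l

theorem IsPolyMap.bilin_mem [FiniteDimensional ℂ W] (β : LinearMap.BilinForm ℂ W)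
    (hF : IsPolyMap F) (hF' : IsPolyMap F') : (fun v => β (F v) (F' v)) ∈ polyFun V := by
  let e := finBasis ℂ W
  have : (fun v => β (F v) (F' v)) = fun v => ∑ i, e.coord i (F v) * β (e i) (F' v) := by
    funext v
    have h : β (F v) (F' v) = β (∑ i, e.repr (F v) i • e i) (F' v) := by rw [e.sum_repr]
    rw [h, map_sum, LinearMap.sum_apply]
    simp only [map_smul, LinearMap.smul_apply, smul_eq_mul, Basis.coord_apply]
  rw [this]
  exact sum_mem_polyFun _ fun i => mul_mem_polyFun (hF _) (hF' _)

end IsPolyMap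

/-- A common induction for the three presentations needed: restriction to a line, coordinates in a
basis, and polynomials in linear functionals. -/
theorem polyFun_induction_eval {A : Type*} [CommRing A] [Algebra ℂ A] {X : Type*}
    (ev : X → A →ₐ[ℂ] ℂ) (pt : X → V) (hlin : ∀ l : Dual ℂ V, ∃ q, ∀ x, ev x q = l (pt x))
    {f : V → ℂ} (hf : f ∈ polyFun V) : ∃ q, ∀ x, ev x q = f (pt x) := by
  induction hf using Algebra.adjoin_induction with
  | mem f hf =>
    obtain ⟨l, rfl⟩ := hf
    exact hlin l
  | algebraMap c => exact ⟨algebraMap ℂ A c, fun x => by rw [AlgHom.commutes]; rfl⟩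
  | add f g _ _ hf hg =>
    obtain ⟨p, hp⟩ := hf
    obtain ⟨q, hq⟩ := hg
    exact ⟨p + q, fun x => by rw [map_add, hp, hq]; rfl⟩
  | mul f g _ _ hf hg =>
    obtain ⟨p, hp⟩ := hf
    obtain ⟨q, hq⟩ := hg
    exact ⟨p * q, fun x => by rw [map_mul, hp, hq]; rfl⟩

theorem exists_polynomial_line {f : V → ℂ} (hf : f ∈ polyFun V) (a d : V) :
    ∃ q : Polynomial ℂ, ∀ t, q.eval t = f (a + t • d) :=
  polyFun_induction_eval (fun t => Polynomial.aeval t) (fun t => a + t • d)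
    (fun l => ⟨Polynomial.C (l a) + Polynomial.X * Polynomial.C (l d), fun t => by simp [mul_comm t]⟩) hf

theorem exists_mvPolynomial_basis {m : ℕ} (b : Basis (Fin m) ℂ V) {f : V → ℂ}
    (hf : f ∈ polyFun V) :
    ∃ q : MvPolynomial (Fin m) ℂ, ∀ v, MvPolynomial.eval (fun i => b.repr v i) q = f v :=
  polyFun_induction_eval (fun v => MvPolynomial.aeval (fun i => b.repr v i)) id
    (fun l => ⟨∑ i, MvPolynomial.C (l (b i)) * MvPolynomial.X i, fun v => by
      have h : l v = ∑ i, l (b i) * b.repr v i := by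
        conv_lhs => rw [← b.sum_repr v]
        simp only [map_sum, map_smul, smul_eq_mul, mul_comm]
      simp [h]⟩) hf

theorem eval_mem_polyFun (p : MvPolynomial (Dual ℂ V) ℂ) :
    (fun v : V => MvPolynomial.eval (fun l : Dual ℂ V => l v) p) ∈ polyFun V := by
  induction p using MvPolynomial.induction_on with
  | C c => simpa using const_mem_polyFun c
  | add p q hp hq =>
    simp only [map_add]
    exact (polyFun V).add_mem hp hq
  | mul_X p l hp =>
    simp only [map_mul, MvPolynomial.eval_X]
    exact mul_mem_polyFun hp (dual_mem_polyFun l)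

theorem forGeneral_iff {P : V → Prop} :
    ForGeneral P ↔ ∃ f ∈ polyFun V, (∃ v, f v ≠ 0) ∧ ∀ v, f v ≠ 0 → P v := by
  constructor
  · rintro ⟨p, hne, hp⟩
    exact ⟨_, eval_mem_polyFun p, hne, hp⟩
  · rintro ⟨f, hf, hne, hP⟩
    obtain ⟨p, hp⟩ := polyFun_induction_eval
      (fun v : V => MvPolynomial.aeval (fun l : Dual ℂ V => l v)) id
      (fun l => ⟨MvPolynomial.X l, fun v => by simp⟩) hf
    have hp' : ∀ v : V, MvPolynomial.eval (fun l : Dual ℂ V => l v) p = f v := hp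
    refine ⟨p, ?_, fun v hv => hP v ?_⟩
    · simpa only [hp'] using hne
    · rwa [hp'] at hv

/-- Restriction to the line from a nonzero of `f` to `w` reduces this to the domain `ℂ[t]`. -/
theorem polyFun_eq_zero_of_mul {f g : V → ℂ} (hf : f ∈ polyFun V) (hg : g ∈ polyFun V)
    (hfg : ∀ v, f v * g v = 0) (hne : ∃ v, f v ≠ 0) (w : V) : g w = 0 := by
  obtain ⟨a, ha⟩ := hne
  obtain ⟨p, hp⟩ := exists_polynomial_line hf a (w - a)
  obtain ⟨q, hq⟩ := exists_polynomial_line hg a (w - a)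
  have hpq : p * q = 0 := Polynomial.funext fun t => by
    rw [Polynomial.eval_mul, hp, hq, hfg, Polynomial.eval_zero]
  rcases mul_eq_zero.1 hpq with h | h
  · exfalso
    apply ha
    have := hp 0
    rw [h] at this
    simpa using this.symm
  · have := hq 1
    rw [h] at this
    simpa using this.symm

/-- A polynomial function vanishing near a point on every line through it vanishes. -/
theorem polyFun_eq_zero_of_line {f : V → ℂ} (hf : f ∈ polyFun V) {a d : V} {S : Set ℂ}
    (hS : S.Infinite) (h : ∀ t ∈ S, f (a + t • d) = 0) (t : ℂ) : f (a + t • d) = 0 := by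
  obtain ⟨p, hp⟩ := exists_polynomial_line hf a d
  have : p = 0 := Polynomial.eq_zero_of_infinite_isRoot p
    (hS.mono fun t ht => by rw [Set.mem_ofPred_eq, Polynomial.IsRoot, hp, h t ht])
  rw [← hp, this, Polynomial.eval_zero]

end PolynomialFunctions

/-! ### Gram determinants -/

section Gram

variable {V : Type*} [AddCommGroup V] [Module ℂ V] {B : LinearMap.BilinForm ℂ V} {r : ℕ}

/-- The Gram matrix of a family of vectors. -/
def gram (B : LinearMap.BilinForm ℂ V) (Y : Fin r → V) : Matrix (Fin r) (Fin r) ℂ :=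
  Matrix.of fun i j => B (Y i) (Y j)

theorem gram_det_ne_zero {Y : Fin r → V} (hY : LinearIndependent ℂ Y)
    (hB : ∀ y ∈ Submodule.span ℂ (Set.range Y), (∀ i, B y (Y i) = 0) → y = 0) :
    (gram B Y).det ≠ 0 := by
  intro h0
  obtain ⟨c, hc, h⟩ := Matrix.exists_vecMul_eq_zero_iff.2 h0
  refine hc (funext ((Fintype.linearIndependent_iff.1 hY) c (hB _ ?_ fun j => ?_)))
  · exact Submodule.sum_mem _ fun i _ => Submodule.smul_mem _ _ (Submodule.subset_span ⟨i, rfl⟩)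
  · have := congrFun h j
    simpa [Matrix.vecMul, dotProduct, gram] using this

theorem linearIndependent_of_gram_det {Y : Fin r → V} (h : (gram B Y).det ≠ 0) :
    LinearIndependent ℂ Y := by
  refine Fintype.linearIndependent_iff.2 fun c hc => ?_
  have : c = 0 := Matrix.eq_zero_of_vecMul_eq_zero h (funext fun j => by
    have := congrArg (fun y => B y (Y j)) hc
    simpa [Matrix.vecMul, dotProduct, gram] using this)
  exact congrFun this

end Gram

/-! ### Exponentials of a Lie algebra and translates of a transversal -/

section Exponential

open Matrix Filter Topology
open scoped Matrix.Norms.Frobenius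

/-- Conjugation by `exp Z` is the exponential of `Y ↦ Y Z - Z Y`, a sum of two commuting
multiplications. The partial sums of its series stay in `h`, which is closed. -/
theorem exp_neg_mul_mul_exp_mem {A : Type*} [NormedRing A] [NormedAlgebra ℂ A] [CompleteSpace A]
    {h : Submodule ℂ A} (hc : IsClosed (h : Set A)) (hlie : ∀ X ∈ h, ∀ Y ∈ h, X * Y - Y * X ∈ h)
    {Z X : A} (hZ : Z ∈ h) (hX : X ∈ h) :
    NormedSpace.exp (-Z) * X * NormedSpace.exp Z ∈ h := by
  let _ : NormedAlgebra ℚ A := NormedAlgebra.restrictScalars ℚ ℂ A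
  let _ : NormedAlgebra ℚ (A →L[ℂ] A) := NormedAlgebra.restrictScalars ℚ ℂ (A →L[ℂ] A)
  let L : A →L[ℂ] A := ContinuousLinearMap.mul ℂ _ (-Z)
  let R : A →L[ℂ] A := (ContinuousLinearMap.mul ℂ _).flip Z
  have hLn : ∀ (n : ℕ) (Y : A), (L ^ n) Y = (-Z) ^ n * Y := fun n Y => by
    induction n with
    | zero => simp
    | succ n ih => rw [pow_succ', pow_succ', mul_assoc, ← ih]; rfl
  have hRn : ∀ (n : ℕ) (Y : A), (R ^ n) Y = Y * Z ^ n := fun n Y => by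
    induction n with
    | zero => simp
    | succ n ih => rw [pow_succ', pow_succ, ← mul_assoc, ← ih]; rfl
  have hexp : ∀ (T : A →L[ℂ] A) (Y : A),
      HasSum (fun n : ℕ => ((n.factorial : ℂ)⁻¹) • (T ^ n) Y) (NormedSpace.exp T Y) := fun T Y =>
    (NormedSpace.exp_series_hasSum_exp' (𝕂 := ℂ) T).mapL (ContinuousLinearMap.apply ℂ _ Y)
  have hexpm : ∀ a : A,
      HasSum (fun n : ℕ => ((n.factorial : ℂ)⁻¹) • a ^ n) (NormedSpace.exp a) := fun a =>
    NormedSpace.exp_series_hasSum_exp' (𝕂 := ℂ) a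
  have hL : ∀ Y, NormedSpace.exp L Y = NormedSpace.exp (-Z) * Y := fun Y => by
    refine (hexp L Y).unique ?_
    simpa only [hLn, smul_mul_assoc] using (hexpm (-Z)).mul_right Y
  have hR : ∀ Y, NormedSpace.exp R Y = Y * NormedSpace.exp Z := fun Y => by
    refine (hexp R Y).unique ?_
    simpa only [hRn, mul_smul_comm] using (hexpm Z).mul_left Y
  have hLR : Commute L R := ContinuousLinearMap.ext fun Y => (mul_assoc (-Z) Y Z).symm
  have hsum := hexp (L + R) X
  rw [NormedSpace.exp_add_of_commute hLR, show (NormedSpace.exp L * NormedSpace.exp R) X =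
    NormedSpace.exp L (NormedSpace.exp R X) from rfl, hR, hL, ← mul_assoc] at hsum
  have hmem : ∀ n : ℕ, ((L + R) ^ n) X ∈ h := fun n => by
    induction n with
    | zero => simpa using hX
    | succ n ih =>
      rw [pow_succ']
      have := hlie _ ih _ hZ
      rwa [show ∀ Y, Y * Z - Z * Y = (L + R) Y from fun Y => by
        change _ = -Z * Y + Y * Z
        rw [neg_mul, neg_add_eq_sub]] at this
  exact hc.mem_of_tendsto hsum
    (Eventually.of_forall fun s => h.sum_mem fun n _ => h.smul_mem _ (hmem n))

variable {ι : Type*} [Fintype ι] [DecidableEq ι] {h : Submodule ℂ (Matrix ι ι ℂ)}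

/-- The map `(Z, u) ↦ exp(Z) u` has derivative `(X, u) ↦ X v₀ + u` at `(0, v₀)`. This is surjective,
so the image contains a neighbourhood of `v₀`. -/
theorem eventually_mem_exp_mulVec (V₀ : Submodule ℂ (ι → ℂ)) {v₀ : ι → ℂ} (hv₀ : v₀ ∈ V₀)
    (hspan : ∀ y, ∃ X ∈ h, ∃ u ∈ V₀, X *ᵥ v₀ + u = y) :
    ∀ᶠ v in 𝓝 v₀, ∃ Z ∈ h, ∃ u ∈ V₀, NormedSpace.exp Z *ᵥ u = v := by
  let M : Matrix ι ι ℂ →L[ℂ] (ι → ℂ) →L[ℂ] (ι → ℂ) := LinearMap.toContinuousLinearMap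
    (LinearMap.toContinuousLinearMap.toLinearMap ∘ₗ
      (toLin' : Matrix ι ι ℂ ≃ₗ[ℂ] _).toLinearMap)
  have hM : ∀ A x, M A x = A *ᵥ x := fun _ _ => rfl
  have : CompleteSpace h :=
    completeSpace_coe_iff_isComplete.2 (Submodule.closed_of_finiteDimensional h).isComplete
  have : CompleteSpace V₀ :=
    completeSpace_coe_iff_isComplete.2 (Submodule.closed_of_finiteDimensional V₀).isComplete
  let hL : h →L[ℂ] Matrix ι ι ℂ := h.subtypeL
  let vL : V₀ →L[ℂ] (ι → ℂ) := V₀.subtypeL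
  let Ψ : h × V₀ → (ι → ℂ) := fun p => M (NormedSpace.exp (hL p.1)) (vL p.2)
  have h1 : HasStrictFDerivAt (fun p : h × V₀ => NormedSpace.exp (hL p.1))
      ((1 : Matrix ι ι ℂ →L[ℂ] Matrix ι ι ℂ).comp (hL.comp (ContinuousLinearMap.fst ℂ h V₀)))
      ((0 : h), (⟨v₀, hv₀⟩ : V₀)) := by
    have h0 : HasStrictFDerivAt NormedSpace.exp (1 : Matrix ι ι ℂ →L[ℂ] Matrix ι ι ℂ)
      (hL.comp (ContinuousLinearMap.fst ℂ h V₀) ((0 : h), (⟨v₀, hv₀⟩ : V₀))) := by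
      have : hL.comp (ContinuousLinearMap.fst ℂ h V₀) ((0 : h), (⟨v₀, hv₀⟩ : V₀)) = 0 := by simp
      rw [this]
      exact hasStrictFDerivAt_exp_zero
    exact h0.comp _ (hL.comp (ContinuousLinearMap.fst ℂ h V₀)).hasStrictFDerivAt
  have h2 := (M.hasStrictFDerivAt.comp _ h1).clm_apply
    (vL.comp (ContinuousLinearMap.snd ℂ h V₀)).hasStrictFDerivAt
  have h3 := h2.map_nhds_eq_of_surj (by
    refine LinearMap.range_eq_top.2 fun y => ?_
    obtain ⟨X, hX, u, hu, rfl⟩ := hspan y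
    refine ⟨((⟨X, hX⟩ : h), (⟨u, hu⟩ : V₀)), ?_⟩
    have h0 : NormedSpace.exp (hL (0 : h)) = 1 := by
      rw [map_zero, NormedSpace.exp_zero]
    rw [h0]
    change (1 : Matrix ι ι ℂ) *ᵥ u + X *ᵥ v₀ = _
    rw [one_mulVec, add_comm])
  have h4 : ∀ᶠ v in map Ψ (𝓝 ((0 : h), (⟨v₀, hv₀⟩ : V₀))),
      ∃ Z ∈ h, ∃ u ∈ V₀, NormedSpace.exp Z *ᵥ u = v :=
    eventually_map.2 (Eventually.of_forall fun p => ⟨p.1, p.1.2, p.2, p.2.2, rfl⟩)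
  have h5 : Ψ ((0 : h), (⟨v₀, hv₀⟩ : V₀)) = v₀ := by
    simp [Ψ, hM, hL, vL]
  have h6 : map Ψ (𝓝 ((0 : h), (⟨v₀, hv₀⟩ : V₀))) =
    𝓝 (Ψ ((0 : h), (⟨v₀, hv₀⟩ : V₀))) := h3
  rwa [h6, h5] at h4

end Exponential

end PolarRep

namespace PolarRep

open Module

/-! ### Orthonormal bases and matrices of skew operators -/

section Frame

open Matrix

variable {V : Type*} [AddCommGroup V] [Module ℂ V] {B : LinearMap.BilinForm ℂ V}

theorem exists_orthonormal_basis [FiniteDimensional ℂ V] (hsymm : B.IsSymm) (hB : B.Nondegenerate) :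
    ∃ b : Basis (Fin (finrank ℂ V)) ℂ V, ∀ x y, B x y = b.equivFun x ⬝ᵥ b.equivFun y := by
  have hassoc : QuadraticMap.associated (R := ℂ) B.toQuadraticMap = B :=
    QuadraticMap.associated_left_inverse ℂ fun x y => hsymm.eq x y
  obtain ⟨I⟩ := QuadraticForm.equivalent_weightedSumSquares_of_isAlgClosed B.toQuadraticMap
    (by rw [hassoc]; exact hB.1)
  let e : V ≃ₗ[ℂ] (Fin (finrank ℂ V) → ℂ) := I.toLinearEquiv
  have hq : ∀ x, B x x = e x ⬝ᵥ e x := fun x => by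
    have := I.map_app x
    rw [QuadraticMap.weightedSumSquares_apply] at this
    simp only [Pi.one_apply, one_smul] at this
    exact this.symm
  refine ⟨Basis.ofEquivFun e, fun x y => ?_⟩
  rw [Basis.equivFun_ofEquivFun]
  have h1 := hq (x + y)
  simp only [map_add, LinearMap.add_apply, dotProduct_add, add_dotProduct, ← hq] at h1
  rw [dotProduct_comm (e y) (e x), show B y x = B x y from hsymm.eq y x] at h1
  linear_combination h1 / 2

variable {ι : Type*} [Fintype ι] [DecidableEq ι] {b : Basis ι ℂ V}

theorem toMatrixAlgEquiv_mulVec (b : Basis ι ℂ V) (X : End ℂ V) (x : V) :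
    LinearMap.toMatrixAlgEquiv b X *ᵥ b.equivFun x = b.equivFun (X x) :=
  LinearMap.toMatrix_mulVec_repr b b X x

theorem toMatrixAlgEquiv_transpose_of_skew
    (hb : ∀ x y, B x y = b.equivFun x ⬝ᵥ b.equivFun y) {X : End ℂ V}
    (hX : ∀ x y, B (X x) y + B x (X y) = 0) :
    (LinearMap.toMatrixAlgEquiv b X)ᵀ = -LinearMap.toMatrixAlgEquiv b X := by
  ext i j
  have := hX (b i) (b j)
  simp only [hb] at this
  rw [transpose_apply, neg_apply, LinearMap.toMatrixAlgEquiv_apply, LinearMap.toMatrixAlgEquiv_apply,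
    eq_neg_iff_add_eq_zero]
  simpa [dotProduct, Basis.equivFun_apply, Finsupp.single_apply] using this

end Frame

/-! ### Density of the translates of a section -/

section Isometries

open Matrix Filter Topology

variable {V : Type*} [AddCommGroup V] [Module ℂ V] [FiniteDimensional ℂ V]
  {B : LinearMap.BilinForm ℂ V} {h : Submodule ℂ (End ℂ V)}

/-- If `V₀` is transverse to the orbits of a Lie algebra of skew operators, then a polynomial
function vanishing on all translates of `V₀` under isometries normalizing the Lie algebra
vanishes. -/
theorem polyFun_eq_zero_of_isometries (hsymm : B.IsSymm) (hB : B.Nondegenerate)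
    (hskew : ∀ X ∈ h, ∀ x y, B (X x) y + B x (X y) = 0)
    (hlie : ∀ X ∈ h, ∀ Y ∈ h, X * Y - Y * X ∈ h) {V₀ : Submodule ℂ V} {v₀ : V} (hv₀ : v₀ ∈ V₀)
    (hspan : ∀ y, ∃ X ∈ h, ∃ u ∈ V₀, X v₀ + u = y) {f : V → ℂ} (hf : f ∈ polyFun V)
    (hzero : ∀ T T' : End ℂ V, T * T' = 1 → T' * T = 1 → (∀ x y, B (T x) (T y) = B x y) →
      (∀ X ∈ h, T' * X * T ∈ h) → (∀ X ∈ h, T * X * T' ∈ h) → ∀ u ∈ V₀, f (T u) = 0) (w : V) :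
    f w = 0 := by
  obtain ⟨b, hb⟩ := exists_orthonormal_basis hsymm hB
  let Ψ := LinearMap.toMatrixAlgEquiv b
  let hm : Submodule ℂ (Matrix _ _ ℂ) := h.map Ψ.toLinearEquiv.toLinearMap
  have hmem : ∀ {X}, X ∈ h → Ψ X ∈ hm := fun hX => Submodule.mem_map_of_mem hX
  have hmem' : ∀ {A}, A ∈ hm → Ψ.symm A ∈ h := by
    rintro _ ⟨X, hX, rfl⟩
    have : Ψ.symm (Ψ X) = X := Ψ.symm_apply_apply X
    rwa [← this] at hX
  have hliem : ∀ X ∈ hm, ∀ Y ∈ hm, X * Y - Y * X ∈ hm := by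
    rintro _ ⟨X, hX, rfl⟩ _ ⟨Y, hY, rfl⟩
    have := hmem (hlie X hX Y hY)
    rwa [map_sub, map_mul, map_mul] at this
  have hev := eventually_mem_exp_mulVec (h := hm) (V₀.map b.equivFun.toLinearMap)
    (Submodule.mem_map_of_mem hv₀) (fun y => by
      obtain ⟨X, hX, u, hu, hy⟩ := hspan (b.equivFun.symm y)
      refine ⟨Ψ X, hmem hX, b.equivFun u, Submodule.mem_map_of_mem hu, ?_⟩
      have := toMatrixAlgEquiv_mulVec b X v₀
      change LinearMap.toMatrixAlgEquiv b X *ᵥ b.equivFun v₀ + _ = _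
      rw [this, ← map_add, hy, LinearEquiv.apply_symm_apply])
  have hnear : ∀ᶠ v in 𝓝 (b.equivFun v₀), f (b.equivFun.symm v) = 0 := by
    filter_upwards [hev] with v hv
    obtain ⟨Z, hZ, _, ⟨u, hu, rfl⟩, rfl⟩ := hv
    have hE : NormedSpace.exp Z * NormedSpace.exp (-Z) = 1 := by
      rw [← Matrix.exp_add_of_commute _ _ (Commute.refl Z).neg_right, add_neg_cancel,
        NormedSpace.exp_zero]
    have hE' : NormedSpace.exp (-Z) * NormedSpace.exp Z = 1 := by
      rw [← Matrix.exp_add_of_commute _ _ (Commute.refl Z).neg_left, neg_add_cancel,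
        NormedSpace.exp_zero]
    have hZt : Zᵀ = -Z := by
      obtain ⟨X, hX, rfl⟩ := hZ
      exact toMatrixAlgEquiv_transpose_of_skew hb (hskew X hX)
    have hconj : ∀ Z ∈ hm, ∀ A ∈ hm, NormedSpace.exp (-Z) * A * NormedSpace.exp Z ∈ hm := by
      open scoped Matrix.Norms.Frobenius in
      exact fun Z hZ A hA =>
        exp_neg_mul_mul_exp_mem (Submodule.closed_of_finiteDimensional hm) hliem hZ hA
    have hT : ∀ x, b.equivFun (Ψ.symm (NormedSpace.exp Z) x) =
        NormedSpace.exp Z *ᵥ b.equivFun x := fun x => by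
      rw [← toMatrixAlgEquiv_mulVec]
      congr 1
      exact Ψ.apply_symm_apply _
    have key := hzero (Ψ.symm (NormedSpace.exp Z)) (Ψ.symm (NormedSpace.exp (-Z)))
      (by rw [← map_mul, hE, map_one]) (by rw [← map_mul, hE', map_one])
      (fun x y => by
        rw [hb, hb, hT, hT, dotProduct_mulVec, ← mulVec_transpose, mulVec_mulVec,
          ← Matrix.exp_transpose, hZt, hE', one_mulVec])
      (fun X hX => by
        have := hmem' (hconj Z hZ _ (hmem hX))
        rwa [map_mul, map_mul, AlgEquiv.symm_apply_apply] at this)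
      (fun X hX => by
        have := hmem' (hconj (-Z) (hm.neg_mem hZ) _ (hmem hX))
        rwa [map_mul, map_mul, AlgEquiv.symm_apply_apply, neg_neg] at this) u hu
    change f (b.equivFun.symm (NormedSpace.exp Z *ᵥ b.equivFun u)) = 0
    rwa [← hT, LinearEquiv.symm_apply_apply]
  -- Vanishing near `v₀` spreads along the complex line to `w`.
  have hline : ∀ᶠ t : ℂ in 𝓝 0, f (v₀ + t • (w - v₀)) = 0 := by
    have hc : Tendsto (fun t : ℂ => b.equivFun v₀ + t • b.equivFun (w - v₀)) (𝓝 0)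
        (𝓝 (b.equivFun v₀)) := by
      have : Continuous fun t : ℂ => b.equivFun v₀ + t • b.equivFun (w - v₀) := by fun_prop
      simpa using this.tendsto 0
    filter_upwards [hc.eventually hnear] with t ht
    rwa [← map_smul, ← map_add, LinearEquiv.symm_apply_apply] at ht
  have := polyFun_eq_zero_of_line hf (infinite_of_mem_nhds 0 hline) (fun t ht => ht) 1
  rwa [one_smul, add_sub_cancel] at this

end Isometries

end PolarRep

namespace PolarRep

open Module

/-! ### Tangent spaces at translates of a section -/

section Tangent

variable {V : Type*} [AddCommGroup V] [Module ℂ V]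
  {B : LinearMap.BilinForm ℂ V} {h : Submodule ℂ (End ℂ V)}

/-- The vectors obtained by applying a space of operators to a vector. -/
def tangent (h : Submodule ℂ (End ℂ V)) (v : V) : Submodule ℂ V := h.map (LinearMap.applyₗ v)

theorem mem_tangent {v y : V} : y ∈ tangent h v ↔ ∃ X ∈ h, X v = y := Iff.rfl

theorem apply_mem_tangent {X : End ℂ V} (hX : X ∈ h) (v : V) : X v ∈ tangent h v := ⟨X, hX, rfl⟩

theorem exists_operators_span_tangent [FiniteDimensional ℂ V] (h : Submodule ℂ (End ℂ V)) (v : V) :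
    ∃ X : Fin (finrank ℂ (tangent h v)) → End ℂ V, (∀ i, X i ∈ h) ∧
      LinearIndependent ℂ (fun i => X i v) ∧
      Submodule.span ℂ (Set.range fun i => X i v) = tangent h v := by
  let e := finBasis ℂ (tangent h v)
  choose X hX hXe using fun i => mem_tangent.1 (e i).2
  refine ⟨X, hX, ?_, ?_⟩
  · simp only [hXe]
    exact e.linearIndependent.map' (tangent h v).subtype (Submodule.ker_subtype _)
  · simp only [hXe]
    have := congrArg (Submodule.map (tangent h v).subtype) e.span_eq
    rwa [Submodule.map_span, ← Set.range_comp, Submodule.map_top, Submodule.range_subtype] at this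

variable {V₀ : Submodule ℂ V} {v₀ : V}

/-- The `V₀`-component of `y` is orthogonal to `V₀` and to `O`, hence to everything. -/
theorem mem_right_of_orthogonal (hsymm : B.IsSymm) (hB : B.Nondegenerate) {O : Submodule ℂ V} (hc : IsCompl V₀ O)
    (horth : ∀ x ∈ V₀, ∀ y ∈ O, B x y = 0) {y : V} (hy : ∀ x ∈ V₀, B x y = 0) : y ∈ O := by
  obtain ⟨a, ha, o, ho, rfl⟩ := Submodule.mem_sup.1 (hc.sup_eq_top.ge (Submodule.mem_top (x := y)))
  have : a = 0 := hB.2 a fun z => by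
    obtain ⟨a', ha', o', ho', rfl⟩ :=
      Submodule.mem_sup.1 (hc.sup_eq_top.ge (Submodule.mem_top (x := z)))
    have h1 := hy a' ha'
    rw [map_add, horth a' ha' o ho, add_zero] at h1
    rw [map_add, LinearMap.add_apply, h1, hsymm.eq o' a, horth a ha o' ho', add_zero]
  rwa [this, zero_add]

theorem mem_left_of_orthogonal (hsymm : B.IsSymm) (hB : B.Nondegenerate) {O : Submodule ℂ V} (hc : IsCompl V₀ O)
    (horth : ∀ x ∈ V₀, ∀ y ∈ O, B x y = 0) {x : V} (hx : ∀ y ∈ O, B x y = 0) : x ∈ V₀ :=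
  mem_right_of_orthogonal hsymm hB hc.symm
    (fun y hy x hx => by rw [hsymm.eq y x]; exact horth x hx y hy)
    fun y hy => by rw [hsymm.eq y x]; exact hx y hy


variable [FiniteDimensional ℂ V]

/-- At a translate `T u` of a point of the section `V₀` by an isometry normalizing `h` where the
tangent space has maximal dimension, any operator of `h` pairs vectors orthogonal to the tangent
space to zero. -/
theorem bilin_apply_eq_zero_of_isometry (hsymm : B.IsSymm) (hB : B.Nondegenerate)
    (hc : IsCompl V₀ (tangent h v₀)) (h0 : ∀ x ∈ V₀, ∀ u ∈ V₀, ∀ X ∈ h, B x (X u) = 0)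
    (hv₀ : v₀ ∈ V₀) {T T' : End ℂ V} (hTT' : T * T' = 1) (hT'T : T' * T = 1)
    (hTB : ∀ x y, B (T x) (T y) = B x y) (hT : ∀ X ∈ h, T' * X * T ∈ h)
    (hT' : ∀ X ∈ h, T * X * T' ∈ h) {u : V} (hu : u ∈ V₀)
    {Y : Fin (finrank ℂ (tangent h v₀)) → V} (hY : LinearIndependent ℂ Y)
    (hYT : ∀ i, Y i ∈ tangent h (T u)) {p q : V} (hp : ∀ i, B p (Y i) = 0)
    (hq : ∀ i, B q (Y i) = 0) {X : End ℂ V} (hX : X ∈ h) : B p (X q) = 0 := by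
  have hTT'a : ∀ x, T (T' x) = x := fun x => congrArg (fun S : End ℂ V => S x) hTT'
  have hT'Ta : ∀ x, T' (T x) = x := fun x => congrArg (fun S : End ℂ V => S x) hT'T
  have hO : ∀ x ∈ V₀, ∀ y ∈ tangent h v₀, B x y = 0 := by
    rintro x hx _ ⟨Z, hZ, rfl⟩
    exact h0 x hx v₀ hv₀ Z hZ
  have hle : tangent h u ≤ tangent h v₀ := by
    rintro _ ⟨Z, hZ, rfl⟩
    exact mem_right_of_orthogonal hsymm hB hc hO fun x hx => h0 x hx u hu Z hZ
  have hmap : tangent h (T u) ≤ (tangent h u).map T := by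
    rintro _ ⟨Z, hZ, rfl⟩
    exact ⟨T' (Z (T u)), apply_mem_tangent (hT Z hZ) u, hTT'a _⟩
  have hr1 : finrank ℂ (tangent h u) ≤ finrank ℂ (tangent h v₀) := Submodule.finrank_mono hle
  have hr2 : finrank ℂ (tangent h (T u)) ≤ finrank ℂ (tangent h u) :=
    (Submodule.finrank_mono hmap).trans (Submodule.finrank_map_le T _)
  have hrY : finrank ℂ (Submodule.span ℂ (Set.range Y)) = finrank ℂ (tangent h v₀) := by
    rw [finrank_span_eq_card hY, Fintype.card_fin]
  have hspanle : Submodule.span ℂ (Set.range Y) ≤ tangent h (T u) :=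
    Submodule.span_le.2 (Set.range_subset_iff.2 hYT)
  -- Dimensions decrease along `h(Tu) ⊆ T(hu)` and `hu ⊆ h v₀`, while `Y` already supplies `dim h
  -- v₀` independent vectors; so all these inclusions are equalities.
  have hspan : Submodule.span ℂ (Set.range Y) = tangent h (T u) :=
    Submodule.eq_of_le_of_finrank_le hspanle (by rw [hrY]; exact hr2.trans hr1)
  have hu_eq : tangent h u = tangent h v₀ :=
    Submodule.eq_of_le_of_finrank_le hle (by
      rw [← hrY]; exact (Submodule.finrank_mono hspanle).trans hr2)
  have hback : ∀ {p}, (∀ i, B p (Y i) = 0) → T' p ∈ V₀ := by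
    intro p hp
    refine mem_left_of_orthogonal hsymm hB hc hO fun y hy => ?_
    rw [← hu_eq] at hy
    obtain ⟨Z, hZ, rfl⟩ := hy
    have hz : T (Z u) ∈ Submodule.span ℂ (Set.range Y) := by
      rw [hspan]
      refine ⟨T * Z * T', hT' Z hZ, ?_⟩
      change T (Z (T' (T u))) = _
      rw [hT'Ta]
    change B (T' p) (Z u) = 0
    rw [← hTB, hTT'a]
    have hker : Submodule.span ℂ (Set.range Y) ≤ LinearMap.ker (B p) :=
      Submodule.span_le.2 (Set.range_subset_iff.2 hp)
    exact hker hz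
  have := h0 (T' p) (hback hp) (T' q) (hback hq) _ (hT X hX)
  rw [← hTB, hTT'a] at this
  change B p (T (T' (X (T (T' q))))) = 0 at this
  rwa [hTT'a, hTT'a] at this

end Tangent

/-! ### The polynomial relation furnished by a section -/

section Relation

open Matrix

variable {V : Type*} [AddCommGroup V] [Module ℂ V] [FiniteDimensional ℂ V]
  {B : LinearMap.BilinForm ℂ V} {h : Submodule ℂ (End ℂ V)} {V₀ : Submodule ℂ V} {v₀ : V}

/-- The existence of a section yields identities expressing `B y (X z)` through the pairings of
`y` and `z` with tangent vectors, with polynomial coefficients. -/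
theorem exists_polynomial_relation (hsymm : B.IsSymm) (hB : B.Nondegenerate)
    (hskew : ∀ X ∈ h, ∀ x y, B (X x) y + B x (X y) = 0)
    (hlie : ∀ X ∈ h, ∀ Y ∈ h, X * Y - Y * X ∈ h) (hv₀ : v₀ ∈ V₀)
    (hc : IsCompl V₀ (tangent h v₀)) (h0 : ∀ x ∈ V₀, ∀ u ∈ V₀, ∀ X ∈ h, B x (X u) = 0) :
    ∃ (r : ℕ) (Y : Fin r → End ℂ V), (∀ i, Y i ∈ h) ∧ ∃ D ∈ polyFun V, (∃ v, D v ≠ 0) ∧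
      ∀ X ∈ h, ∃ p q : Fin r → V → V → ℂ, (∀ i y, p i y ∈ polyFun V) ∧
        (∀ i y, q i y ∈ polyFun V) ∧ ∀ v y z, D v * B y (X z) =
          ∑ i, B y (Y i v) * p i z v + ∑ i, B z (Y i v) * q i y v := by
  have hO : ∀ x ∈ V₀, ∀ y ∈ tangent h v₀, B x y = 0 := by
    rintro x hx _ ⟨Z, hZ, rfl⟩
    exact h0 x hx v₀ hv₀ Z hZ
  obtain ⟨Y, hY, hYind, hYspan⟩ := exists_operators_span_tangent h v₀
  let A : V → Matrix _ _ ℂ := fun v => gram B fun i => Y i v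
  let Δ : V → ℂ := fun v => (A v).det
  -- The family `R i v` is `Δ` times the dual basis of `Y i v`, written with the adjugate so that it
  -- stays polynomial; `P` is the corresponding multiple of the projection.
  let R : Fin (finrank ℂ (tangent h v₀)) → V → V := fun i v => ∑ j, (A v).adjugate j i • Y j v
  let P : V → V → V := fun y v => Δ v • y - ∑ i, B y (Y i v) • R i v
  have hYpoly : ∀ i, IsPolyMap fun v => Y i v := fun i => IsPolyMap.of_linear (Y i)
  have hA : ∀ i j, (fun v => A v i j) ∈ polyFun V := fun i j =>
    IsPolyMap.bilin_mem B (hYpoly i) (hYpoly j)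
  have hΔ : Δ ∈ polyFun V := det_mem_polyFun hA
  have hR : ∀ i, IsPolyMap (R i) := fun i =>
    IsPolyMap.sum _ fun j => IsPolyMap.smul (adjugate_mem_polyFun hA j i) (hYpoly j)
  have hP : ∀ y, IsPolyMap (P y) := fun y =>
    IsPolyMap.sub (IsPolyMap.smul hΔ (IsPolyMap.const y)) (IsPolyMap.sum _ fun i =>
      IsPolyMap.smul (IsPolyMap.bilin_mem B (IsPolyMap.const y) (hYpoly i)) (hR i))
  have hΔ0 : ∃ v, Δ v ≠ 0 := by
    refine ⟨v₀, gram_det_ne_zero hYind fun y hy hyY => ?_⟩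
    rw [hYspan] at hy
    have hy' : y ∈ V₀ := mem_left_of_orthogonal hsymm hB hc hO fun z hz => by
      rw [← hYspan] at hz
      have hker : Submodule.span ℂ (Set.range fun i => Y i v₀) ≤ LinearMap.ker (B y) :=
        Submodule.span_le.2 (Set.range_subset_iff.2 hyY)
      exact hker hz
    exact (Submodule.disjoint_def.1 hc.disjoint) y hy' hy
  have hRY : ∀ i k v, B (R i v) (Y k v) = if i = k then Δ v else 0 := fun i k v => by
    have h1 := congrFun (congrFun (mul_adjugate (A v)) k) i
    rw [mul_apply] at h1
    simp only [R, map_sum, LinearMap.sum_apply, map_smul, LinearMap.smul_apply, smul_eq_mul]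
    rw [Matrix.smul_apply, one_apply, smul_eq_mul, mul_ite, mul_one, mul_zero] at h1
    simp only [eq_comm (a := i) (b := k)]
    rw [← h1]
    refine Finset.sum_congr rfl fun j _ => ?_
    rw [mul_comm, hsymm.eq (Y j v) (Y k v)]
    rfl
  have hPY : ∀ y v k, B (P y v) (Y k v) = 0 := fun y v k => by
    simp only [P, map_sub, map_sum, LinearMap.sub_apply, LinearMap.sum_apply, map_smul,
      LinearMap.smul_apply, smul_eq_mul, hRY, mul_ite, mul_zero, Finset.sum_ite_eq',
      Finset.mem_univ, if_true]
    ring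
  have hmain : ∀ X ∈ h, ∀ y z v, B (P y v) (X (P z v)) = 0 := by
    intro X hX y z v
    have hmem : (fun v => B (P y v) (X (P z v))) ∈ polyFun V :=
      IsPolyMap.bilin_mem B (hP y) ((hP z).linear_comp X)
    -- The factor `Δ` disposes of translates where the tangent vectors degenerate and is cancelled
    -- afterwards.
    refine polyFun_eq_zero_of_mul hΔ hmem ?_ hΔ0 v
    refine polyFun_eq_zero_of_isometries hsymm hB hskew hlie hv₀ (fun y => ?_)
      (mul_mem_polyFun hΔ hmem) fun T T' h1 h2 hTB hT hT' u hu => ?_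
    · obtain ⟨a, ha, _, ⟨Z, hZ, rfl⟩, hy⟩ :=
        Submodule.mem_sup.1 (hc.sup_eq_top.ge (Submodule.mem_top (x := y)))
      exact ⟨Z, hZ, a, ha, by rw [← hy, add_comm]; rfl⟩
    · by_cases hd : Δ (T u) = 0
      · rw [hd, zero_mul]
      · rw [bilin_apply_eq_zero_of_isometry hsymm hB hc h0 hv₀ h1 h2 hTB hT hT' hu
          (linearIndependent_of_gram_det hd) (fun i => apply_mem_tangent (hY i) _)
          (hPY y _) (hPY z _) hX, mul_zero]
  -- Each of the two projections contributes one factor `Δ`. Expanding first in `y` keeps `P z`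
  -- inside the coefficients `p`; expanding `P z` then gives `q`.
  refine ⟨_, Y, hY, fun v => Δ v * Δ v, mul_mem_polyFun hΔ hΔ, ?_, fun X hX =>
    ⟨fun i z v => B (R i v) (X (P z v)), fun i y v => Δ v * B y (X (R i v)),
    fun i z => IsPolyMap.bilin_mem B (hR i) ((hP z).linear_comp X),
    fun i y => mul_mem_polyFun hΔ
      (IsPolyMap.bilin_mem B (IsPolyMap.const y) ((hR i).linear_comp X)), fun v y z => ?_⟩⟩
  · obtain ⟨v, hv⟩ := hΔ0
    exact ⟨v, mul_ne_zero hv hv⟩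
  · have h1 := hmain X hX y z v
    have h2 : B (P y v) (X (P z v)) =
        Δ v * B y (X (P z v)) - ∑ i, B y (Y i v) * B (R i v) (X (P z v)) := by
      conv_lhs => rw [show P y v = Δ v • y - ∑ i, B y (Y i v) • R i v from rfl]
      simp only [map_sub, map_sum, LinearMap.sub_apply, LinearMap.sum_apply, map_smul,
        LinearMap.smul_apply, smul_eq_mul]
    have h3 : B y (X (P z v)) = Δ v * B y (X z) - ∑ i, B z (Y i v) * B y (X (R i v)) := by
      conv_lhs => rw [show P z v = Δ v • z - ∑ i, B z (Y i v) • R i v from rfl]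
      simp only [map_sub, map_sum, map_smul, smul_eq_mul]
    have h4 : ∑ i, B z (Y i v) * (Δ v * B y (X (R i v))) =
        Δ v * ∑ i, B z (Y i v) * B y (X (R i v)) := by
      rw [Finset.mul_sum]
      exact Finset.sum_congr rfl fun i _ => by ring
    rw [h4]
    rw [h2, h3] at h1
    linear_combination h1

end Relation

end PolarRep

namespace PolarRep

open Module

/-! ### The criterion over the field of rational functions -/

section Criterion

variable {V : Type*} [AddCommGroup V] [Module ℂ V] {B : LinearMap.BilinForm ℂ V} {m : ℕ}
  {b : Basis (Fin m) ℂ V}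

theorem eval_repr_mem_polyFun (b : Basis (Fin m) ℂ V) (p : MvPolynomial (Fin m) ℂ) :
    (fun v => MvPolynomial.eval (fun i => b.repr v i) p) ∈ polyFun V := by
  induction p using MvPolynomial.induction_on with
  | C c => simpa using const_mem_polyFun c
  | add p q hp hq =>
    simp only [map_add]
    exact (polyFun V).add_mem hp hq
  | mul_X p i hp =>
    simp only [map_mul, MvPolynomial.eval_X]
    exact mul_mem_polyFun hp (dual_mem_polyFun (b.coord i))

theorem mvPolynomial_ext_basis (b : Basis (Fin m) ℂ V) {p q : MvPolynomial (Fin m) ℂ}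
    (h : ∀ v, MvPolynomial.eval (fun i => b.repr v i) p =
      MvPolynomial.eval (fun i => b.repr v i) q) : p = q :=
  MvPolynomial.funext fun x => by
    have := h (b.equivFun.symm x)
    rwa [show (fun i => b.repr (b.equivFun.symm x) i) = x from
      b.equivFun.apply_symm_apply x] at this

/-- The linear form `v ↦ B (b k) (φ v)` in coordinates. -/
noncomputable def pairingCoeff (B : LinearMap.BilinForm ℂ V) (b : Basis (Fin m) ℂ V)
    (φ : End ℂ V) (k : Fin m) : MvPolynomial (Fin m) ℂ :=
  ∑ l, MvPolynomial.C (B (b k) (φ (b l))) * MvPolynomial.X l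

theorem eval_pairingCoeff (φ : End ℂ V) (k : Fin m) (v : V) :
    MvPolynomial.eval (fun i => b.repr v i) (pairingCoeff B b φ k) = B (b k) (φ v) := by
  conv_rhs => rw [← b.sum_repr v]
  simp only [pairingCoeff, map_sum, map_mul, map_smul, MvPolynomial.eval_C, MvPolynomial.eval_X,
    smul_eq_mul, mul_comm]

theorem genericPairing_eq (s : Fin m → Fin m ⊕ Fin m) (φ : End ℂ V) :
    genericPairing B b s φ = ∑ k, MvPolynomial.C (algebraMap (MvPolynomial (Fin m) ℂ)
      (RatFunField m) (pairingCoeff B b φ k)) * MvPolynomial.X (s k) := by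
  refine Finset.sum_congr rfl fun k _ => ?_
  rw [pairingCoeff, map_sum, map_sum, Finset.sum_mul]
  refine Finset.sum_congr rfl fun l _ => ?_
  rw [map_mul (algebraMap (MvPolynomial (Fin m) ℂ) (RatFunField m)),
    IsScalarTower.algebraMap_apply ℂ (MvPolynomial (Fin m) ℂ) (RatFunField m),
    MvPolynomial.algebraMap_eq]

/-- The form `⟨u | φ v⟩` or `⟨w | φ v⟩` as a linear map in `φ`. -/
theorem exists_linearMap_genericPairing (s : Fin m → Fin m ⊕ Fin m) :
    ∃ Λ : End ℂ V →ₗ[ℂ] PairRing m, ∀ φ, Λ φ = genericPairing B b s φ :=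
  ⟨{ toFun := genericPairing B b s
     map_add' := fun φ ψ => by
      simp only [genericPairing, ← Finset.sum_add_distrib, LinearMap.add_apply, map_add, add_mul]
     map_smul' := fun c φ => by
      simp only [genericPairing, Finset.smul_sum, LinearMap.smul_apply, map_smul, smul_eq_mul,
        map_mul, RingHom.id_apply]
      refine Finset.sum_congr rfl fun k _ => Finset.sum_congr rfl fun l _ => ?_
      rw [Algebra.smul_def]
      simp only [mul_assoc]
      rfl }, fun _ => rfl⟩

theorem exists_linearMap_quadraticPairing (B : LinearMap.BilinForm ℂ V) (b : Basis (Fin m) ℂ V) :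
    ∃ Λ : End ℂ V →ₗ[ℂ] PairRing m, ∀ φ, Λ φ = quadraticPairing B b φ :=
  ⟨{ toFun := quadraticPairing B b
     map_add' := fun φ ψ => by
      simp only [quadraticPairing, ← Finset.sum_add_distrib, LinearMap.add_apply, map_add, add_mul]
     map_smul' := fun c φ => by
      simp only [quadraticPairing, Finset.smul_sum, LinearMap.smul_apply, map_smul, smul_eq_mul,
        map_mul, RingHom.id_apply]
      refine Finset.sum_congr rfl fun k _ => Finset.sum_congr rfl fun l _ => ?_
      rw [Algebra.smul_def]
      simp only [mul_assoc]
      rfl }, fun _ => rfl⟩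

variable {κ : Type} {φ : κ → End ℂ V}

theorem mul_genericPairing_mem_span {s : Fin m → Fin m ⊕ Fin m} (hs : s = Sum.inl ∨ s = Sum.inr)
    {Y : End ℂ V} (hY : Y ∈ Submodule.span ℂ (Set.range φ)) (t : Fin m ⊕ Fin m)
    (c : RatFunField m) :
    MvPolynomial.C c * (MvPolynomial.X t * genericPairing B b s Y) ∈
      Submodule.span (RatFunField m) (products B b φ) := by
  rw [← MvPolynomial.smul_eq_C_mul]
  refine Submodule.smul_mem _ c ?_
  obtain ⟨Λ, hΛ⟩ := exists_linearMap_genericPairing (B := B) (b := b) s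
  let S : Submodule ℂ (PairRing m) :=
    (Submodule.span (RatFunField m) (products B b φ)).restrictScalars ℂ
  suffices h : Submodule.span ℂ (Set.range φ) ≤
      S.comap ((LinearMap.mulLeft ℂ (MvPolynomial.X t)) ∘ₗ Λ) by
    have := h hY
    rw [Submodule.mem_comap, LinearMap.comp_apply, hΛ, LinearMap.mulLeft_apply] at this
    exact this
  refine Submodule.span_le.2 (Set.range_subset_iff.2 fun i => ?_)
  change MvPolynomial.X t * Λ (φ i) ∈ Submodule.span (RatFunField m) (products B b φ)
  refine Submodule.subset_span ⟨MvPolynomial.X t, MvPolynomial.isHomogeneous_X ℂ t, i, ?_⟩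
  rw [hΛ, MvPolynomial.map_X]
  rcases hs with rfl | rfl
  · exact Or.inl rfl
  · exact Or.inr rfl

/-- The relation at basis vectors `y = b k`, `z = b l` is an identity of polynomials in `v`.
Multiplying by the monomials and summing gives the quadratic form, up to the invertible factor `D`.
-/
theorem quadraticPairing_mem_span_of_relation {r : ℕ} {Y : Fin r → End ℂ V}
    (hY : ∀ i, Y i ∈ Submodule.span ℂ (Set.range φ)) {D : V → ℂ} (hD : D ∈ polyFun V)
    (hD0 : ∃ v, D v ≠ 0) {X : End ℂ V} {p q : Fin r → V → V → ℂ}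
    (hp : ∀ i y, p i y ∈ polyFun V) (hq : ∀ i y, q i y ∈ polyFun V)
    (hrel : ∀ v y z, D v * B y (X z) =
      ∑ i, B y (Y i v) * p i z v + ∑ i, B z (Y i v) * q i y v) :
    quadraticPairing B b X ∈ Submodule.span (RatFunField m) (products B b φ) := by
  obtain ⟨d, hd⟩ := exists_mvPolynomial_basis b hD
  choose p' hp' using fun i l => exists_mvPolynomial_basis b (hp i (b l))
  choose q' hq' using fun i k => exists_mvPolynomial_basis b (hq i (b k))
  have hd0 : d ≠ 0 := by
    rintro rfl
    obtain ⟨v, hv⟩ := hD0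
    exact hv (by rw [← hd, map_zero])
  let a := algebraMap (MvPolynomial (Fin m) ℂ) (RatFunField m)
  have ha0 : a d ≠ 0 := fun h0 =>
    hd0 (IsFractionRing.injective (MvPolynomial (Fin m) ℂ) (RatFunField m) (by rw [map_zero]; exact h0))
  have hpoly : ∀ k l, d * MvPolynomial.C (B (b k) (X (b l))) =
      ∑ i, pairingCoeff B b (Y i) k * p' i l + ∑ i, pairingCoeff B b (Y i) l * q' i k :=
    fun k l => mvPolynomial_ext_basis b fun v => by
      simp only [map_mul, map_add, map_sum, MvPolynomial.eval_C, eval_pairingCoeff, hd, hp', hq']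
      exact hrel v (b k) (b l)
  have hmain : MvPolynomial.C (a d) * quadraticPairing B b X =
      ∑ l, ∑ i, MvPolynomial.C (a (p' i l)) *
        (MvPolynomial.X (Sum.inr l) * genericPairing B b Sum.inl (Y i)) +
      ∑ k, ∑ i, MvPolynomial.C (a (q' i k)) *
        (MvPolynomial.X (Sum.inl k) * genericPairing B b Sum.inr (Y i)) := by
    have h1 : MvPolynomial.C (a d) * quadraticPairing B b X =
        ∑ k, ∑ l, (MvPolynomial.C (a (d * MvPolynomial.C (B (b k) (X (b l))))) : PairRing m) *
          (MvPolynomial.X (Sum.inl k) * MvPolynomial.X (Sum.inr l)) := by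
      simp only [quadraticPairing, Finset.mul_sum]
      refine Finset.sum_congr rfl fun k _ => Finset.sum_congr rfl fun l _ => ?_
      rw [← mul_assoc, map_mul, map_mul,
        IsScalarTower.algebraMap_apply ℂ (MvPolynomial (Fin m) ℂ) (RatFunField m),
        MvPolynomial.algebraMap_eq]
    rw [h1]
    simp only [hpoly, map_add, map_sum, map_mul, add_mul, Finset.sum_add_distrib, Finset.sum_mul,
      genericPairing_eq, Finset.mul_sum]
    congr 1
    · rw [Finset.sum_comm]
      refine Finset.sum_congr rfl fun l _ => ?_
      rw [Finset.sum_comm]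
      refine Finset.sum_congr rfl fun i _ => Finset.sum_congr rfl fun k _ => ?_
      ring
    · refine Finset.sum_congr rfl fun k _ => ?_
      rw [Finset.sum_comm]
      refine Finset.sum_congr rfl fun i _ => Finset.sum_congr rfl fun l _ => ?_
      ring
  have : quadraticPairing B b X = (a d)⁻¹ • (MvPolynomial.C (a d) * quadraticPairing B b X) := by
    rw [← MvPolynomial.smul_eq_C_mul, smul_smul, inv_mul_cancel₀ ha0, one_smul]
  rw [this, hmain]
  refine Submodule.smul_mem _ _ (Submodule.add_mem _ ?_ ?_)
  · exact Submodule.sum_mem _ fun l _ => Submodule.sum_mem _ fun i _ =>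
      mul_genericPairing_mem_span (Or.inl rfl) (hY i) _ _
  · exact Submodule.sum_mem _ fun l _ => Submodule.sum_mem _ fun i _ =>
      mul_genericPairing_mem_span (Or.inr rfl) (hY i) _ _

/-- Evaluation at points of `V`, `U` and `W`. -/
noncomputable def tripleEval (b : Basis (Fin m) ℂ V) (v u w : V) :
    MvPolynomial (Fin m ⊕ Fin m) (MvPolynomial (Fin m) ℂ) →+* ℂ :=
  MvPolynomial.eval₂Hom (MvPolynomial.eval fun i => b.repr v i)
    (Sum.elim (fun i => b.repr u i) fun i => b.repr w i)

/-- Rational coefficients cannot be evaluated at a point, so each element of the span is carried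
with a denominator and a numerator having polynomial coefficients. Vanishing of the numerator at the
relevant points is inherited through the span. -/
theorem exists_numerator_of_mem_span {f : PairRing m}
    (hf : f ∈ Submodule.span (RatFunField m) (products B b φ)) :
    ∃ D : MvPolynomial (Fin m) ℂ, D ≠ 0 ∧
      ∃ F : MvPolynomial (Fin m ⊕ Fin m) (MvPolynomial (Fin m) ℂ),
        MvPolynomial.C (algebraMap _ (RatFunField m) D) * f =
          MvPolynomial.map (algebraMap _ (RatFunField m)) F ∧
        ∀ v u w, (∀ i, B u (φ i v) = 0) → (∀ i, B w (φ i v) = 0) → tripleEval b v u w F = 0 := by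
  have hgp : ∀ (s : Fin m → Fin m ⊕ Fin m) (X : End ℂ V), ∃ F,
      MvPolynomial.map (algebraMap _ (RatFunField m)) F = genericPairing B b s X ∧
      ∀ v u w, tripleEval b v u w F =
        ∑ k, B (b k) (X v) * Sum.elim (fun i => b.repr u i) (fun i => b.repr w i) (s k) := by
    intro s X
    refine ⟨∑ k, MvPolynomial.C (pairingCoeff B b X k) * MvPolynomial.X (s k), ?_, fun v u w => ?_⟩
    · rw [genericPairing_eq]
      simp only [map_sum, map_mul, MvPolynomial.map_C, MvPolynomial.map_X]
    · simp only [tripleEval, map_sum, map_mul, MvPolynomial.coe_eval₂Hom, MvPolynomial.eval₂_C,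
        MvPolynomial.eval₂_X, eval_pairingCoeff]
  have hsum : ∀ u y : V, ∑ k, B (b k) y * b.repr u k = B u y := fun u y => by
    have : B u y = B (∑ k, b.repr u k • b k) y := by rw [b.sum_repr]
    rw [this, map_sum, LinearMap.sum_apply]
    simp only [map_smul, LinearMap.smul_apply, smul_eq_mul, mul_comm]
  have hgen : ∀ (q : MvPolynomial (Fin m ⊕ Fin m) ℂ) (s : Fin m → Fin m ⊕ Fin m) (X : End ℂ V)
      (P : V → V → V → Prop), (∀ v u w, P v u w →
        ∑ k, B (b k) (X v) * Sum.elim (fun i => b.repr u i) (fun i => b.repr w i) (s k) = 0) →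
      ∃ D : MvPolynomial (Fin m) ℂ, D ≠ 0 ∧
      ∃ F : MvPolynomial (Fin m ⊕ Fin m) (MvPolynomial (Fin m) ℂ),
        MvPolynomial.C (algebraMap _ (RatFunField m) D) *
          (MvPolynomial.map (algebraMap ℂ (RatFunField m)) q * genericPairing B b s X) =
          MvPolynomial.map (algebraMap _ (RatFunField m)) F ∧
        ∀ v u w, P v u w → tripleEval b v u w F = 0 := by
    intro q s X P hP
    obtain ⟨F, hF, hFe⟩ := hgp s X
    refine ⟨1, one_ne_zero, MvPolynomial.map MvPolynomial.C q * F, ?_, fun v u w h => ?_⟩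
    · rw [map_one, map_one, one_mul, map_mul, hF, MvPolynomial.map_map]
      rfl
    · rw [map_mul, hFe, hP v u w h, mul_zero]
  induction hf using Submodule.span_induction with
  | mem f hf =>
    obtain ⟨q, -, i, rfl | rfl⟩ := hf
    · obtain ⟨D, hD, F, hF, hv⟩ := hgen q Sum.inl (φ i) (fun v u w => B u (φ i v) = 0)
        fun v u w h => by simpa only [Sum.elim_inl, hsum] using h
      exact ⟨D, hD, F, hF, fun v u w hu _ => hv v u w (hu i)⟩
    · obtain ⟨D, hD, F, hF, hv⟩ := hgen q Sum.inr (φ i) (fun v u w => B w (φ i v) = 0)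
        fun v u w h => by simpa only [Sum.elim_inr, hsum] using h
      exact ⟨D, hD, F, hF, fun v u w _ hw => hv v u w (hw i)⟩
  | zero => exact ⟨1, one_ne_zero, 0, by simp, fun _ _ _ _ _ => map_zero _⟩
  | add f g _ _ hf hg =>
    obtain ⟨D, hD, F, hF, hv⟩ := hf
    obtain ⟨D', hD', F', hF', hv'⟩ := hg
    refine ⟨D * D', mul_ne_zero hD hD', MvPolynomial.C D' * F + MvPolynomial.C D * F', ?_,
      fun v u w hu hw => ?_⟩
    · simp only [map_add, map_mul, MvPolynomial.map_C, ← hF, ← hF']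
      ring
    · rw [map_add, map_mul, map_mul, hv v u w hu hw, hv' v u w hu hw, mul_zero, mul_zero, add_zero]
  | smul c f _ hf =>
    obtain ⟨D, hD, F, hF, hv⟩ := hf
    obtain ⟨x, y, hy, rfl⟩ := IsFractionRing.div_surjective (A := MvPolynomial (Fin m) ℂ) c
    have hy0 : y ≠ 0 := nonZeroDivisors.ne_zero hy
    have ha0 : algebraMap (MvPolynomial (Fin m) ℂ) (RatFunField m) y ≠ 0 := fun h0 =>
      hy0 (IsFractionRing.injective (MvPolynomial (Fin m) ℂ) (RatFunField m)
        (by rw [map_zero]; exact h0))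
    refine ⟨y * D, mul_ne_zero hy0 hD, MvPolynomial.C x * F, ?_, fun v u w hu hw => ?_⟩
    · rw [map_mul (MvPolynomial.map _), MvPolynomial.map_C, ← hF, MvPolynomial.smul_eq_C_mul,
        ← mul_assoc, ← mul_assoc, ← MvPolynomial.C_mul, ← MvPolynomial.C_mul,
        map_mul (algebraMap _ _) y D]
      congr 2
      field_simp
    · rw [map_mul, hv v u w hu hw, mul_zero]

theorem exists_denominator_of_mem_span {X : End ℂ V}
    (hX : quadraticPairing B b X ∈ Submodule.span (RatFunField m) (products B b φ)) :
    ∃ D : MvPolynomial (Fin m) ℂ, D ≠ 0 ∧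
      ∀ v, MvPolynomial.eval (fun i => b.repr v i) D ≠ 0 → ∀ u w, (∀ i, B u (φ i v) = 0) →
        (∀ i, B w (φ i v) = 0) → B u (X w) = 0 := by
  obtain ⟨D, hD, F, hF, hv⟩ := exists_numerator_of_mem_span hX
  refine ⟨D, hD, fun v hDv u w hu hw => ?_⟩
  let Q : MvPolynomial (Fin m ⊕ Fin m) (MvPolynomial (Fin m) ℂ) :=
    ∑ k, ∑ l, MvPolynomial.C (MvPolynomial.C (B (b k) (X (b l)))) *
      (MvPolynomial.X (Sum.inl k) * MvPolynomial.X (Sum.inr l))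
  have hQ : MvPolynomial.map (algebraMap _ (RatFunField m)) Q = quadraticPairing B b X := by
    simp only [Q, quadraticPairing, map_sum, map_mul, MvPolynomial.map_C, MvPolynomial.map_X,
      IsScalarTower.algebraMap_apply ℂ (MvPolynomial (Fin m) ℂ) (RatFunField m),
      MvPolynomial.algebraMap_eq]
  -- Polynomials embed in rational functions, so the numerator is `D` times the polynomial lift of
  -- the quadratic form.
  have hFQ : F = MvPolynomial.C D * Q :=
    MvPolynomial.map_injective _
      (IsFractionRing.injective (MvPolynomial (Fin m) ℂ) (RatFunField m)) (by
        rw [← hF, map_mul, MvPolynomial.map_C, hQ])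
  have h0 := hv v u w hu hw
  have hQe : tripleEval b v u w Q = B u (X w) := by
    have hBu : B u (X w) = B (∑ k, b.repr u k • b k) (X (∑ l, b.repr w l • b l)) := by
      rw [b.sum_repr, b.sum_repr]
    rw [hBu]
    simp only [map_sum, LinearMap.sum_apply, map_smul, LinearMap.smul_apply, smul_eq_mul, Q,
      tripleEval, map_mul, MvPolynomial.coe_eval₂Hom, MvPolynomial.eval₂_C,
      MvPolynomial.eval₂_X, MvPolynomial.eval_C, Sum.elim_inl, Sum.elim_inr]
    rw [Finset.sum_comm]
    refine Finset.sum_congr rfl fun l _ => ?_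
    rw [Finset.mul_sum]
    exact Finset.sum_congr rfl fun k _ => by ring
  rw [hFQ, map_mul, hQe] at h0
  have hC : tripleEval b v u w (MvPolynomial.C D) =
      MvPolynomial.eval (fun i => b.repr v i) D := MvPolynomial.eval₂_C _ _ _
  rw [hC] at h0
  exact (mul_eq_zero.1 h0).resolve_left hDv

/-- The rational criterion implies the condition at general points. -/
theorem forGeneral_of_rationalCriterion [FiniteDimensional ℂ V] {h : Submodule ℂ (End ℂ V)}
    (hφ : Submodule.span ℂ (Set.range φ) = h) (hcrit : RationalCriterion B b φ) :
    ForGeneral fun v : V => ∀ u₁ u₂ : V, (∀ y ∈ tangent h v, B u₁ y = 0) →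
      (∀ y ∈ tangent h v, B u₂ y = 0) → ∀ y ∈ tangent h u₂, B u₁ y = 0 := by
  have hmem : ∀ X ∈ h, quadraticPairing B b X ∈
      Submodule.span (RatFunField m) (products B b φ) := by
    obtain ⟨Λ, hΛ⟩ := exists_linearMap_quadraticPairing B b
    intro X hX
    have hle : Submodule.span ℂ (Set.range φ) ≤
        ((Submodule.span (RatFunField m) (products B b φ)).restrictScalars ℂ).comap Λ :=
      Submodule.span_le.2 (Set.range_subset_iff.2 fun i => by
        change Λ (φ i) ∈ Submodule.span (RatFunField m) (products B b φ)
        rw [hΛ]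
        exact hcrit i)
    rw [← hφ] at hX
    have := hle hX
    rw [Submodule.mem_comap, hΛ] at this
    exact this
  -- The family `φ` need not be finite; a basis of `h ⊆ End V` leaves finitely many denominators to
  -- multiply.
  let e := finBasis ℂ h
  choose D hD hDv using fun i => exists_denominator_of_mem_span (hmem (e i) (e i).2)
  refine forGeneral_iff.2 ⟨_, eval_repr_mem_polyFun b (∏ i, D i), ?_, fun v hv u w hu hw => ?_⟩
  · by_contra! hne
    have h0 : ∏ i, D i = 0 := mvPolynomial_ext_basis b fun v => by rw [hne v, map_zero]
    exact Finset.prod_ne_zero_iff.2 (fun i _ => hD i) h0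
  · rw [map_prod] at hv
    have hφv : ∀ i, φ i v ∈ tangent h v := fun i =>
      apply_mem_tangent (hφ ▸ Submodule.subset_span ⟨i, rfl⟩) v
    have he : ∀ i, B u ((e i : End ℂ V) w) = 0 := fun i =>
      hDv i v (Finset.prod_ne_zero_iff.1 hv i (Finset.mem_univ i)) u w
        (fun j => hu _ (hφv j)) fun j => hw _ (hφv j)
    rintro _ ⟨X, hX, rfl⟩
    have hXe : X = ∑ i, e.repr ⟨X, hX⟩ i • (e i : End ℂ V) := by
      have := congrArg (Submodule.subtype h) (e.sum_repr ⟨X, hX⟩)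
      simpa only [map_sum, map_smul, Submodule.subtype_apply] using this.symm
    change B u (X w) = 0
    rw [hXe, LinearMap.sum_apply, map_sum]
    refine Finset.sum_eq_zero fun i _ => ?_
    rw [LinearMap.smul_apply, map_smul, he, smul_zero]

end Criterion

end PolarRep

namespace PolarRep

open Module

/-! ### Construction of a section at a general real point -/

section RealPoint

open Matrix

variable {V : Type*} [AddCommGroup V] [Module ℂ V] [FiniteDimensional ℂ V]
  {B : LinearMap.BilinForm ℂ V} {h C : Submodule ℂ (End ℂ V)}

/-- A semisimple Lie algebra of skew operators has an orthonormal basis in which it is normalized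
by the adjoints of its elements. -/
theorem exists_orthonormal_basis_normalizes (hsymm : B.IsSymm) (hB : B.Nondegenerate)
    (hskew : ∀ X ∈ h, ∀ x y, B (X x) y + B x (X y) = 0)
    (hlie : ∀ X ∈ h, ∀ Y ∈ h, X * Y - Y * X ∈ h) (hC : IsCompl h C)
    (hCad : ∀ X ∈ h, ∀ Y ∈ C, X * Y - Y * X ∈ C)
    (hss : ∀ K : Submodule ℂ V, (∀ X ∈ h, ∀ x ∈ K, X x ∈ K) →
      ∃ K' : Submodule ℂ V, IsCompl K K' ∧ ∀ X ∈ h, ∀ x ∈ K', X x ∈ K') :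
    ∃ b : Basis (Fin (finrank ℂ V)) ℂ V, (∀ x y, B x y = b.equivFun x ⬝ᵥ b.equivFun y) ∧
      ∀ X ∈ h, ∀ Y ∈ h, ∃ W ∈ h,
        (LinearMap.toMatrixAlgEquiv b X)ᴴ * LinearMap.toMatrixAlgEquiv b Y -
          LinearMap.toMatrixAlgEquiv b Y * (LinearMap.toMatrixAlgEquiv b X)ᴴ =
        LinearMap.toMatrixAlgEquiv b W := by
  obtain ⟨b, hb⟩ := exists_orthonormal_basis hsymm hB
  let Ψ := LinearMap.toMatrixAlgEquiv b
  have hmap : ∀ {S : Submodule ℂ (End ℂ V)},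
      (∀ X ∈ h, ∀ Y ∈ S, X * Y - Y * X ∈ S) → ∀ X ∈ h.map Ψ.toLinearEquiv.toLinearMap,
        ∀ Y ∈ S.map Ψ.toLinearEquiv.toLinearMap,
        X * Y - Y * X ∈ S.map Ψ.toLinearEquiv.toLinearMap := by
    rintro S hS _ ⟨X, hX, rfl⟩ _ ⟨Y, hY, rfl⟩
    refine ⟨X * Y - Y * X, hS X hX Y hY, ?_⟩
    change Ψ (X * Y - Y * X) = Ψ X * Ψ Y - Ψ Y * Ψ X
    rw [map_sub, map_mul, map_mul]
  obtain ⟨g, hg, hgn⟩ := exists_frame_conjTranspose_normalizes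
    (h := h.map Ψ.toLinearEquiv.toLinearMap) (C := C.map Ψ.toLinearEquiv.toLinearMap)
    (by
      rintro _ ⟨X, hX, rfl⟩
      exact toMatrixAlgEquiv_transpose_of_skew hb (hskew X hX))
    (hmap hlie) ((Submodule.orderIsoMapComap Ψ.toLinearEquiv).isCompl hC) (hmap hCad)
    (by
      intro K hK
      obtain ⟨K', hKK', hK'⟩ := hss (K.comap b.equivFun.toLinearMap) fun X hX x hx => by
        have := hK (Ψ X) ⟨X, hX, rfl⟩ _ hx
        change LinearMap.toMatrixAlgEquiv b X *ᵥ b.equivFun x ∈ K at this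
        rwa [toMatrixAlgEquiv_mulVec] at this
      refine ⟨K'.map b.equivFun.toLinearMap, ?_, ?_⟩
      · have := (Submodule.orderIsoMapComap b.equivFun).isCompl hKK'
        rwa [show (Submodule.orderIsoMapComap b.equivFun) (K.comap b.equivFun.toLinearMap) = K from
          Submodule.map_comap_eq_of_surjective b.equivFun.surjective K] at this
      · rintro _ ⟨X, hX, rfl⟩ _ ⟨x, hx, rfl⟩
        exact ⟨X x, hK' X hX x hx, (toMatrixAlgEquiv_mulVec b X x).symm⟩)
  have hg' : g * gᵀ = 1 := mul_eq_one_comm.1 hg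
  -- Composing coordinates with the orthogonal `g` keeps the basis orthonormal and conjugates the
  -- matrices of `h` by `g`.
  let e : V ≃ₗ[ℂ] (Fin (finrank ℂ V) → ℂ) := b.equivFun.trans (toLin'OfInv hg hg')
  have he : ∀ x, e x = g *ᵥ b.equivFun x := fun _ => rfl
  let b' := Basis.ofEquivFun e
  have hb' : ∀ x, b'.equivFun x = g *ᵥ b.equivFun x := fun x => by
    rw [Basis.equivFun_ofEquivFun, he]
  have hM : ∀ X, LinearMap.toMatrixAlgEquiv b' X = g * Ψ X * gᵀ := fun X => by
    refine toLin'.injective (LinearMap.ext fun y => ?_)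
    obtain ⟨x, rfl⟩ := b'.equivFun.surjective y
    rw [toLin'_apply, toLin'_apply, toMatrixAlgEquiv_mulVec, hb', hb', mulVec_mulVec, mul_assoc, hg,
      mul_one, ← mulVec_mulVec, show Ψ X *ᵥ b.equivFun x = _ from toMatrixAlgEquiv_mulVec b X x]
  refine ⟨b', fun x y => ?_, fun X hX Y hY => ?_⟩
  · rw [hb', hb', dotProduct_mulVec, ← mulVec_transpose, mulVec_mulVec, hg, one_mulVec, hb]
  · obtain ⟨_, ⟨W, hW, rfl⟩, hWe⟩ := hgn (Ψ X) ⟨X, hX, rfl⟩ (Ψ Y) ⟨Y, hY, rfl⟩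
    refine ⟨W, hW, ?_⟩
    rw [hM, hM, hM]
    exact hWe

/-- A nonzero polynomial function does not vanish at all real points. -/
theorem exists_real_ne_zero {V : Type*} [AddCommGroup V] [Module ℂ V] {m : ℕ} (b : Basis (Fin m) ℂ V) {f : V → ℂ} (hf : f ∈ polyFun V)
    (hne : ∃ v, f v ≠ 0) : ∃ v, star (b.equivFun v) = b.equivFun v ∧ f v ≠ 0 := by
  obtain ⟨w, hw⟩ := hne
  by_contra! hall
  let a : V := b.equivFun.symm fun i => ((b.equivFun w i).re : ℂ)
  let c : V := b.equivFun.symm fun i => ((b.equivFun w i).im : ℂ)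
  have hwac : w = a + Complex.I • c := by
    apply b.equivFun.injective
    rw [map_add, map_smul, LinearEquiv.apply_symm_apply, LinearEquiv.apply_symm_apply]
    funext i
    simp [mul_comm Complex.I]
  refine hw ?_
  rw [hwac]
  -- On the line `a + t c` the points with real `t` are real; `w` is its point at `t = I`.
  refine polyFun_eq_zero_of_line hf
    (Set.infinite_range_of_injective Complex.ofReal_injective) ?_ Complex.I
  rintro _ ⟨t, rfl⟩
  refine hall _ ?_
  rw [map_add, map_smul, LinearEquiv.apply_symm_apply, LinearEquiv.apply_symm_apply]
  funext i
  simp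

/-- The implication from the condition at general points to the existence of a section. -/
theorem exists_section_of_forGeneral (hsymm : B.IsSymm) (hB : B.Nondegenerate)
    (hskew : ∀ X ∈ h, ∀ x y, B (X x) y + B x (X y) = 0)
    (hlie : ∀ X ∈ h, ∀ Y ∈ h, X * Y - Y * X ∈ h) (hC : IsCompl h C)
    (hCad : ∀ X ∈ h, ∀ Y ∈ C, X * Y - Y * X ∈ C)
    (hss : ∀ K : Submodule ℂ V, (∀ X ∈ h, ∀ x ∈ K, X x ∈ K) →
      ∃ K' : Submodule ℂ V, IsCompl K K' ∧ ∀ X ∈ h, ∀ x ∈ K', X x ∈ K')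
    (hgen : ForGeneral fun v : V => ∀ u₁ u₂ : V, (∀ y ∈ tangent h v, B u₁ y = 0) →
      (∀ y ∈ tangent h v, B u₂ y = 0) → ∀ y ∈ tangent h u₂, B u₁ y = 0) :
    ∃ V₀ : Submodule ℂ V, ForGeneral fun v₀ : V₀ =>
      IsCompl V₀ (tangent h (v₀ : V)) ∧ ∀ x ∈ V₀, ∀ y ∈ tangent h (v₀ : V), B x y = 0 := by
  obtain ⟨b, hb, hnorm⟩ := exists_orthonormal_basis_normalizes hsymm hB hskew hlie hC hCad hss
  obtain ⟨f, hf, hne, hfP⟩ := forGeneral_iff.1 hgen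
  obtain ⟨v, hvreal, hfv⟩ := exists_real_ne_zero b hf hne
  have hcomm := hfP v hfv
  have hM : ∀ X x, LinearMap.toMatrixAlgEquiv b X *ᵥ b.equivFun x = b.equivFun (X x) :=
    toMatrixAlgEquiv_mulVec b
  have hperp : ∀ {u : Fin (finrank ℂ V) → ℂ},
      (∀ A ∈ h.map (LinearMap.toMatrixAlgEquiv b).toLinearEquiv.toLinearMap,
        u ⬝ᵥ (A *ᵥ b.equivFun v) = 0) → ∀ y ∈ tangent h v, B (b.equivFun.symm u) y = 0 := by
    rintro u hu _ ⟨X, hX, rfl⟩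
    rw [hb, LinearEquiv.apply_symm_apply, LinearMap.applyₗ_apply_apply, ← hM]
    exact hu _ ⟨X, hX, rfl⟩
  have hnd : ∀ y ∈ tangent h v, (∀ z ∈ tangent h v, B y z = 0) → y = 0 := by
    rintro _ ⟨X, hX, rfl⟩ hXv
    have := eq_zero_of_orthogonal_of_real
      (h := h.map (LinearMap.toMatrixAlgEquiv b).toLinearEquiv.toLinearMap)
      (X := LinearMap.toMatrixAlgEquiv b X)
      (by
        rintro _ ⟨X, hX, rfl⟩
        exact toMatrixAlgEquiv_transpose_of_skew hb (hskew X hX))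
      (by
        rintro _ ⟨X, hX, rfl⟩ _ ⟨Y, hY, rfl⟩
        obtain ⟨W, hW, hWe⟩ := hnorm X hX Y hY
        exact ⟨W, hW, hWe.symm⟩)
      hvreal
      (by
        rintro u₁ u₂ h₁ h₂ _ ⟨X, hX, rfl⟩
        have := hcomm _ _ (hperp h₁) (hperp h₂) _ (apply_mem_tangent hX _)
        rw [hb, LinearEquiv.apply_symm_apply, ← hM, LinearEquiv.apply_symm_apply] at this
        exact this)
      ⟨X, hX, rfl⟩
      (by
        rintro _ ⟨Y, hY, rfl⟩
        have := hXv _ (apply_mem_tangent hY v)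
        rw [hb, LinearMap.applyₗ_apply_apply, ← hM, ← hM] at this
        exact this)
    rw [hM] at this
    exact b.equivFun.map_eq_zero_iff.1 this
  let T := tangent h v
  let V₀ := B.orthogonal T
  have hmem : ∀ {x}, x ∈ V₀ ↔ ∀ y ∈ T, B x y = 0 := fun {x} => by
    rw [LinearMap.BilinForm.mem_orthogonal_iff]
    exact forall₂_congr fun y _ => by rw [← hsymm.eq y x]
  have hc : IsCompl V₀ T := by
    refine ((LinearMap.BilinForm.isCompl_orthogonal_iff_disjoint hsymm.isRefl).2 ?_).symm
    rw [Submodule.disjoint_def]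
    exact fun x hx hx' => hnd x hx (hmem.1 hx')
  have horth : ∀ x ∈ V₀, ∀ y ∈ T, B x y = 0 := fun x hx => hmem.1 hx
  -- Skewness gives `B v (X v) = 0`; thus `v` itself witnesses that the Gram determinant is not
  -- identically zero on `V₀`.
  have hvV₀ : v ∈ V₀ := hmem.2 (by
    rintro _ ⟨X, hX, rfl⟩
    have := hskew X hX v v
    rw [hsymm.eq (X v) v] at this
    change B v (X v) = 0
    linear_combination this / 2)
  have hle : ∀ u ∈ V₀, tangent h u ≤ T := fun u hu y hy =>
    mem_right_of_orthogonal hsymm hB hc horth fun x hx =>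
      hcomm x u (hmem.1 hx) (hmem.1 hu) y hy
  obtain ⟨Y, hY, hYind, hYspan⟩ := exists_operators_span_tangent h v
  refine ⟨V₀, forGeneral_iff.2 ⟨fun u : V₀ => (gram B fun i => Y i u).det,
    det_mem_polyFun fun i j => IsPolyMap.bilin_mem B
      (IsPolyMap.of_linear (Y i ∘ₗ V₀.subtype)) (IsPolyMap.of_linear (Y j ∘ₗ V₀.subtype)),
    ⟨⟨v, hvV₀⟩, gram_det_ne_zero hYind fun y hy hyY => ?_⟩, fun u hu => ?_⟩⟩
  · rw [hYspan] at hy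
    refine hnd y hy fun z hz => ?_
    rw [← hYspan] at hz
    have hker : Submodule.span ℂ (Set.range fun i => Y i v) ≤ LinearMap.ker (B y) :=
      Submodule.span_le.2 (Set.range_subset_iff.2 hyY)
    exact hker hz
  · have hind := linearIndependent_of_gram_det hu
    have hspan : Submodule.span ℂ (Set.range fun i => Y i (u : V)) ≤ tangent h (u : V) :=
      Submodule.span_le.2 (Set.range_subset_iff.2 fun i => apply_mem_tangent (hY i) _)
    -- The inclusion `h u ⊆ h v` comes from the hypothesis at `v`; independence of the `Y i u`
    -- forces equality.
    have hTu : tangent h (u : V) = T := Submodule.eq_of_le_of_finrank_le (hle u u.2) (by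
      have := Submodule.finrank_mono hspan
      rwa [finrank_span_eq_card hind, Fintype.card_fin] at this)
    rw [hTu]
    exact ⟨hc, horth⟩

end RealPoint

end PolarRep

/-! ### The cycle of implications -/

theorem mainTheorem5 {n : ℕ} (G : Subgroup (GL (Fin n) ℂ)) (hG : PolarRep.IsReductive G)
    {V : Type*} [AddCommGroup V] [Module ℂ V] [FiniteDimensional ℂ V]
    (B : LinearMap.BilinForm ℂ V) (hsymm : B.IsSymm) (hB : B.Nondegenerate)
    (ρ : Representation ℂ G V) (hρ : PolarRep.IsAlgebraicRep ρ)
    (horth : ∀ (g : G) (x y : V), B (ρ g x) (ρ g y) = B x y) :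
    (PolarRep.HasSection hρ B ↔ PolarRep.GenerallyTransitive hρ B) ∧
    ∀ {m : ℕ} (b : Module.Basis (Fin m) ℂ V) {κ : Type}
      (φ : Module.Basis κ ℂ (PolarRep.lieAlg G)),
      PolarRep.HasSection hρ B ↔
        PolarRep.RationalCriterion B b (fun i => PolarRep.differential hρ (φ i)) := by
  open PolarRep Module in
  let h := LinearMap.range (differential hρ)
  have htan : ∀ v, orbitTangent hρ v = tangent h v := fun v => by
    ext y
    constructor
    · rintro ⟨δ, rfl⟩
      exact ⟨_, ⟨δ, rfl⟩, rfl⟩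
    · rintro ⟨_, ⟨δ, rfl⟩, rfl⟩
      exact ⟨δ, rfl⟩
  have hskew : ∀ X ∈ h, ∀ x y, B (X x) y + B x (X y) = 0 := by
    rintro _ ⟨δ, rfl⟩ x y
    exact differential_skew hρ horth δ x y
  have hlie : ∀ X ∈ h, ∀ Y ∈ h, X * Y - Y * X ∈ h := fun X hX Y hY =>
    commutator_mem_range_differential hρ hB horth hX hY
  have h13 : ∀ {m : ℕ} (b : Basis (Fin m) ℂ V) {κ : Type} (φ : Basis κ ℂ (lieAlg G)),
      HasSection hρ B → RationalCriterion B b fun i => differential hρ (φ i) := by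
    rintro m b κ φ ⟨V₀, hV₀⟩ j
    simp only [htan] at hV₀
    obtain ⟨f, hf, ⟨v₀, hfv₀⟩, hP⟩ := forGeneral_iff.1 hV₀
    -- Orthogonality is given at general `u ∈ V₀` only; being polynomial in `u`, it extends to all
    -- of `V₀`.
    have h0 : ∀ x ∈ V₀, ∀ u ∈ V₀, ∀ X ∈ h, B x (X u) = 0 := fun x hx u hu X hX =>
      polyFun_eq_zero_of_mul hf (dual_mem_polyFun (B x ∘ₗ X ∘ₗ V₀.subtype)) (fun v => by
        by_cases hv : f v = 0
        · rw [hv, zero_mul]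
        · rw [show (B x ∘ₗ X ∘ₗ V₀.subtype) v = 0 from
            (hP v hv).2 x hx _ (apply_mem_tangent hX _), mul_zero]) ⟨v₀, hfv₀⟩ ⟨u, hu⟩
    obtain ⟨r, Y, hY, D, hD, hD0, hrel⟩ := exists_polynomial_relation hsymm hB hskew hlie v₀.2
      (hP v₀ hfv₀).1 h0
    obtain ⟨p, q, hp, hq, hpq⟩ := hrel (differential hρ (φ j)) ⟨φ j, rfl⟩
    refine quadraticPairing_mem_span_of_relation (fun i => ?_) hD hD0 hp hq hpq
    have hspan : Submodule.span ℂ (Set.range fun i => differential hρ (φ i)) = h := by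
      rw [Set.range_comp', Submodule.span_image, φ.span_eq, Submodule.map_top]
    rw [hspan]
    exact hY i
  have h32 : ∀ {m : ℕ} (b : Basis (Fin m) ℂ V) {κ : Type} (φ : Basis κ ℂ (lieAlg G)),
      (RationalCriterion B b fun i => differential hρ (φ i)) → GenerallyTransitive hρ B := by
    intro m b κ φ hcrit
    have hspan : Submodule.span ℂ (Set.range fun i => differential hρ (φ i)) = h := by
      rw [Set.range_comp', Submodule.span_image, φ.span_eq, Submodule.map_top]
    simpa only [GenerallyTransitive, htan] using forGeneral_of_rationalCriterion hspan hcrit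
  -- Reductivity enters here, through an ad-stable complement of `h` in `End V` and complete
  -- reducibility of `V` under `h`.
  have h21 : GenerallyTransitive hρ B → HasSection hρ B := by
    intro hgen
    simp only [GenerallyTransitive, htan] at hgen
    obtain ⟨C, hC, hCad⟩ := hG.exists_isCompl_range hρ hB horth
    simpa only [HasSection, htan] using exists_section_of_forGeneral hsymm hB hskew hlie hC hCad
      (fun K hK => hG.exists_isCompl_of_differential hρ hK) hgen
  exact ⟨⟨fun h1 => h32 (finBasis ℂ V) (Basis.ofVectorSpace ℂ (lieAlg G))
    (h13 _ _ h1), h21⟩, fun b κ φ => ⟨h13 b φ, fun h3 => h21 (h32 b φ h3)⟩⟩
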